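/- **Programs and HT-models.** Let $\Sigma$ be a set of atoms. A (body) literal is $a$, $not\,a$ or $not\,not\,a$ with $a\in\Sigma$. A rule $r$ is $H(r)\leftarrow B(r)$ with $H(r)$ a finite set of atoms and $B(r)$ a finite set of literals; $B^+(r)$, $B^-(r)$, $B^{--}(r)$ are the sets of atoms $a$ with $a$, $not\,a$, $not\,not\,a$ in $B(r)$, respectively. A program $P$ is a finite set of rules; $\Sigma(P)$, $\Sigma(r)$ are the sets of atoms occurring in $P$, $r$. The reduct is $P^Y=\{H(r)\leftarrow B^+(r): r\in P,\ B^-(r)\cap Y=\emptyset,\ B^{--}(r)\subseteq Y\}$. For $S\subseteq\Sigma$ let $\mathcal{HT}_S(P)$ be the set of pairs $\langle X,Y\rangle$ with $X\subseteq Y\subseteq S$, $Y\models P$ and $X\models P^Y$ (classical satisfaction). **The class $\mathsf F_{SP}$.** A forgetting operator is a partial function $\mathsf f$ mapping a program $P$ and a set $V\subseteq\Sigma$ to a program $\mathsf f(P,V)$ over $\Sigma(P)\setminus V$. For $Y\subseteq\Sigma\setminus V$ let $$Rel^Y_{\langle P,V\rangle}=\{A\subseteq V: \langle Y\cup A,Y\cup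 A\rangle\in \mathcal{HT}_{\Sigma(P)}(P)\text{ and there is no }A'\subsetneq A\text{ with }\langle Y\cup A',Y\cup A\rangle\in\mathcal{HT}_{\Sigma(P)}(P)\},$$ $R^{Y,A}_{\langle P,V\rangle}=\{X\setminus V:\langle X,Y\cup A\rangle\in\mathcal{HT}_{\Sigma(P)}(P)\}$ and $\mathcal R^Y_{\langle P,V\rangle}=\{R^{Y,A}_{\langle P,V\rangle}:A\in Rel^Y_{\langle P,V\rangle}\}$, with the convention $\bigcap\emptyset=\emptyset$. Then $\mathsf F_{SP}$ is the set of forgetting operators $\mathsf f$ such that, whenever $\mathsf f(P,V)$ is defined, $$\mathcal{HT}_{\Sigma(P)\setminus V}(\mathsf f(P,V))=\{\langle X,Y\rangle: Y\subseteq\Sigma(P)\setminus V,\ X\in\textstyle\bigcap\mathcal R^Y_{\langle P,V\rangle}\}.$$ **Normal form.** A rule $r$ is tautological if $H(r)\cap B^+(r)$, $B^+(r)\cap B^-(r)$ or $B^-(r)\cap B^{--}(r)$ is non-empty. A rule $r\in P$ is minimal in $P$ if there is no $r'\in P$ with $H(r')\subseteq H(r)$ and $B(r')\subsetneq B(r)$,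 or with $H(r')\subsetneq H(r)$ and $B(r')\subseteq B(r)$. $NF(P)$ is obtained from $P$ by (1) removing all tautological rules; (2) removing $not\,not\,a$ from $B(r)$ whenever $a\in B(r)$; (3) removing $a$ from $H(r)$ whenever $not\,a\in B(r)$; (4) removing all rules not minimal in the resulting program. **The operator $\mathsf f_{SP}$.** For a set $S$ of atoms or literals let $not(S)=\{not\,s:s\in S\}$ and $not\,not(S)=\{not\,not\,s:s\in S\}$, where $not\,not\,not\,a$ is simplified to $not\,a$ and $not\,not\,not\,not\,a$ to $not\,not\,a$. Let $B^{\setminus q}(r)=B(r)\setminus\{q,not\,q,not\,not\,q\}$ and $H^{\setminus q}(r)=H(r)\setminus\{q\}$. For a set of rules $Q$, $\mathcal D^q(Q)$ is the set of all $not(\{l_r:r\in F\})\cup not\,not(\{h_r:r\in Q\setminus F\})$ with $F\subseteq Q$, $l_r\in B^{\setminus q}(r)$ for $r\in F$ and $h_r\in H^{\setminus q}(r)$ for $r\in Q\setminus F$. Given $P$ and $q\in\Sigma$, put $P'=NF(P)$ and $R=\{r\in P':q\notin\Sigma(r)\}$, $R_0=\{r\in P':q\in B(r)\}$, $R_1=\{r\in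 P':not\,q\in B(r)\}$, $R_2=\{r\in P':not\,not\,q\in B(r),\,q\notin H(r)\}$, $R_3=\{r\in P':not\,not\,q\in B(r),\,q\in H(r)\}$, $R_4=\{r\in P':not\,not\,q\notin B(r),\,q\in H(r)\}$. Then $\mathsf f_{SP}(P,q)=NF(P'')$, where $P''$ consists of all rules in $R$ and the following rules. * (1a) For $r_0\in R_0$, $r_4\in R_4$: $H(r_0)\cup H^{\setminus q}(r_4)\leftarrow B^{\setminus q}(r_0)\cup B(r_4)$. * (2a) For $r_0\in R_0$, $r_3\in R_3$, $r'\in R_1\cup R_4$: $H(r_0)\cup H^{\setminus q}(r_3)\leftarrow B^{\setminus q}(r_0)\cup B^{\setminus q}(r_3)\cup not(H^{\setminus q}(r'))\cup not\,not(B^{\setminus q}(r'))$. * (3a) For $r_0\in R_0$, $r_3\in R_3$, $h\in H(r_0)$, $D\in\mathcal D^q((R_0\cup R_2)\setminus\{r_0\})$: $H(r_0)\leftarrow B^{\setminus q}(r_0)\cup\{not\,not\,h\}\cup D\cup B^{\setminus q}(r_3)\cup not(H^{\setminus q}(r_3))$. * (1b) For $r_2\in R_2$, $r_4\in R_4$: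 $H(r_2)\leftarrow B^{\setminus q}(r_2)\cup not(H^{\setminus q}(r_4))\cup not\,not(B(r_4))$. * (2b) For $r_2\in R_2$, $r_3\in R_3$, $r'\in R_1\cup R_4$: $H(r_2)\leftarrow B^{\setminus q}(r_2)\cup not(H^{\setminus q}(r_3)\cup H^{\setminus q}(r'))\cup not\,not(B^{\setminus q}(r_3)\cup B^{\setminus q}(r'))$. * (3b) For $r_2\in R_2$, $r_3\in R_3$, $h\in H(r_2)$, $D\in\mathcal D^q((R_0\cup R_2)\setminus\{r_2\})$: $H(r_2)\leftarrow B^{\setminus q}(r_2)\cup not(H^{\setminus q}(r_3))\cup not\,not(B^{\setminus q}(r_3)\cup\{h\})\cup D$. * (4) For $r'\in R_1\cup R_4$, $D\in\mathcal D^q(R_3\cup R_4)$ with $D\cap not(B^{\setminus q}(r'))=\emptyset$: $H^{\setminus q}(r')\leftarrow B^{\setminus q}(r')\cup D$. * (5) For $r'\in R_1\cup R_4$, $r_3\in R_3$, $r\in R_0\cup R_2$, $D\in\mathcal D^q(R_4)$ with $D\cap not(B^{\setminus q}(r'))=\emptyset$: $H^{\setminus q}(r')\leftarrow B^{\setminus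 q}(r')\cup not(H(r)\cup H^{\setminus q}(r_3))\cup not\,not(B^{\setminus q}(r)\cup B^{\setminus q}(r_3))\cup D$. * (6) For $r'\in R_1\cup R_4$, $r_3\in R_3$, $h\in H^{\setminus q}(r')$, $D\in\mathcal D^q((R_1\cup R_4)\setminus\{r'\})$: $H^{\setminus q}(r')\leftarrow B^{\setminus q}(r')\cup not(H^{\setminus q}(r_3))\cup not\,not(B^{\setminus q}(r_3)\cup\{h\})\cup D$. * (7) For $r_0\in R_0$, $r_3,r_3'\in R_3$ with $r_3\neq r_3'$, $h\in H(r_0)$, $D\in\mathcal D^q((R_0\cup R_2)\setminus\{r_0\})$: $H(r_0)\cup H^{\setminus q}(r_3)\leftarrow B^{\setminus q}(r_0)\cup B^{\setminus q}(r_3)\cup not(H^{\setminus q}(r_3'))\cup not\,not(B^{\setminus q}(r_3')\cup\{h\})\cup D$. **Theorem.** The operator $(P,\{q\})\mapsto\mathsf f_{SP}(P,q)$, defined for all programs $P$ over $\Sigma$ and all singletons $\{q\}\subseteq\Sigma$, belongs to $\mathsf F_{SP}$. Moreover, for every $\mathsf f\in\mathsf F_{SP}$, every program $P$ over $\Sigma$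 and every $q\in\Sigma$ such that $\mathsf f(P,\{q\})$ is defined, $\mathsf f_{SP}(P,q)$ and $\mathsf f(P,\{q\})$ have the same HT-models: $\mathcal{HT}_S(\mathsf f_{SP}(P,q))=\mathcal{HT}_S(\mathsf f(P,\{q\}))$ for every $S\subseteq\Sigma$. -/

import Mathlib

namespace ASP

/-- Body literals over the atoms `α`: `a`, `not a` and `not not a`. -/
inductive Lit (α : Type*) where
  | pos (a : α) : Lit α
  | neg (a : α) : Lit α
  | nneg (a : α) : Lit α
  deriving DecidableEq

/-- The atom occurring in a literal. -/
def Lit.atom {α : Type*} : Lit α → α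
  | .pos a => a
  | .neg a => a
  | .nneg a => a

/-- `not l`, with `not not not a` simplified to `not a`. -/
def Lit.naf {α : Type*} : Lit α → Lit α
  | .pos a => .neg a
  | .neg a => .nneg a
  | .nneg a => .neg a

/-- `not not l`, with `not not not a` simplified to `not a` and `not not not not a`
simplified to `not not a`. -/
def Lit.nafnaf {α : Type*} : Lit α → Lit α
  | .pos a => .nneg a
  | .neg a => .neg a
  | .nneg a => .nneg a

/-- An extended rule `a₁ ∨ … ∨ aₖ ← b₁,…, bₗ, not c₁,…, not cₘ, not not d₁,…, not not dₙ`,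
given by its head `{a₁,…,aₖ}` and the set of its body literals. -/
@[ext]
structure Rule (α : Type*) where
  head : Finset α
  body : Finset (Lit α)
  deriving DecidableEq

/-- An extended logic program: a finite set of rules. -/
abbrev Program (α : Type*) := Finset (Rule α)

section Syntax_basics

variable {α : Type*} [DecidableEq α]

/-- The atoms occurring in a rule. -/
def Rule.sig (r : Rule α) : Finset α := r.head ∪ r.body.image Lit.atom

/-- `Σ(P)`: the atoms occurring in a program. -/
def sig (P : Program α) : Finset α := P.biUnion Rule.sig

/-- The body without all literals on `q`. -/
def Rule.bodyWo (q : α) (r : Rule α) : Finset (Lit α) := r.body.filter fun l => l.atom ≠ q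

/-- The head without `q`. -/
def Rule.headWo (q : α) (r : Rule α) : Finset α := r.head.erase q

/-- `not (H)` for a set of atoms `H`. -/
def nots (H : Finset α) : Finset (Lit α) := H.image Lit.neg

/-- `not not (H)` for a set of atoms `H`. -/
def notnots (H : Finset α) : Finset (Lit α) := H.image Lit.nneg

/-- `not (B)` for a set of literals `B`. -/
def notLits (B : Finset (Lit α)) : Finset (Lit α) := B.image Lit.naf

/-- `not not (B)` for a set of literals `B`. -/
def notnotLits (B : Finset (Lit α)) : Finset (Lit α) := B.image Lit.nafnaf

end Syntax_basics

/-! ### Here-and-there semantics -/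

section Semantics

variable {α : Type*}

/-- Classical satisfaction of a rule by an interpretation `I` (a set of atoms). -/
def Rule.Sat (I : Set α) (r : Rule α) : Prop :=
  (∀ a, Lit.pos a ∈ r.body → a ∈ I) → (∀ a, Lit.neg a ∈ r.body → a ∉ I) →
    (∀ a, Lit.nneg a ∈ r.body → a ∈ I) → ∃ a ∈ r.head, a ∈ I

/-- Classical satisfaction of a set of rules. -/
def Models (I : Set α) (P : Set (Rule α)) : Prop := ∀ r ∈ P, r.Sat I

/-- The positive part `H(r) ← B⁺(r)` of a rule. -/
def Rule.posPart [DecidableEq α] (r : Rule α) : Rule α :=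
  ⟨r.head, r.body.filter fun l => l = .pos l.atom⟩

/-- The reduct of `P` given `I`. -/
def reduct [DecidableEq α] (P : Program α) (I : Set α) : Set (Rule α) :=
  {s | ∃ r ∈ P, (∀ a, Lit.neg a ∈ r.body → a ∉ I) ∧ (∀ a, Lit.nneg a ∈ r.body → a ∈ I) ∧
    s = r.posPart}

/-- The HT-models of `P` among the HT-interpretations over the set of atoms `S`. -/
def HT [DecidableEq α] (S : Set α) (P : Program α) : Set (Set α × Set α) :=
  {I | I.1 ⊆ I.2 ∧ I.2 ⊆ S ∧ Models I.2 (↑P : Set (Rule α)) ∧ Models I.1 (reduct P I.2)}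

end Semantics

/-! ### The semantic class of forgetting operators -/

section SemanticClass

variable {α : Type*} [DecidableEq α]

/-- `Rel_{⟨P,V⟩}^Y`. -/
def Rel (P : Program α) (V Y : Set α) : Set (Set α) :=
  {A | A ⊆ V ∧ (Y ∪ A, Y ∪ A) ∈ HT (↑(sig P)) P ∧
    ¬ ∃ A', A' ⊂ A ∧ (Y ∪ A', Y ∪ A) ∈ HT (↑(sig P)) P}

/-- `R_{⟨P,V⟩}^{Y,A}`. -/
def RYA (P : Program α) (V Y A : Set α) : Set (Set α) :=
  {Z | ∃ X, (X, Y ∪ A) ∈ HT (↑(sig P)) P ∧ Z = X \ V}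

/-- `ℛ_{⟨P,V⟩}^Y`. -/
def RY (P : Program α) (V Y : Set α) : Set (Set (Set α)) :=
  {M | ∃ A ∈ Rel P V Y, M = RYA P V Y A}

/-- The intersection `⋂ ℛ_{⟨P,V⟩}^Y`, which is empty if the family `ℛ_{⟨P,V⟩}^Y` is empty. -/
def interRY (P : Program α) (V Y : Set α) : Set (Set α) :=
  {X | (RY P V Y).Nonempty ∧ ∀ M ∈ RY P V Y, X ∈ M}

/-- A forgetting operator: a partial function taking a program `P` and a set `V` of atoms to a
program over `Σ(P) \ V`. -/
def IsForgettingOperator (f : Program α × Set α →. Program α) : Prop :=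
  ∀ P V, ∀ P' ∈ f (P, V), (↑(sig P') : Set α) ⊆ ↑(sig P) \ V

/-- The class `F_SP`. The result of forgetting is a program over `Σ(P) \ V`, and its HT-models are
taken over that signature. -/
def FSP (α : Type*) [DecidableEq α] : Set (Program α × Set α →. Program α) :=
  {f | IsForgettingOperator f ∧ ∀ P V, ∀ P' ∈ f (P, V),
    HT (↑(sig P) \ V) P' = {I | I.2 ⊆ ↑(sig P) \ V ∧ I.1 ∈ interRY P V I.2}}

end SemanticClass

/-! ### Normal form -/

section NormalForm

variable {α : Type*} [DecidableEq α]

/-- Tautological rules. -/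
def Rule.Tautological (r : Rule α) : Prop :=
  (∃ a ∈ r.head, Lit.pos a ∈ r.body) ∨
    (∃ a ∈ r.sig, Lit.pos a ∈ r.body ∧ Lit.neg a ∈ r.body) ∨
    (∃ a ∈ r.sig, Lit.neg a ∈ r.body ∧ Lit.nneg a ∈ r.body)

instance (r : Rule α) : Decidable r.Tautological := by
  unfold Rule.Tautological; infer_instance

/-- Remove `not not a` from the body whenever `a` is in the body. -/
def Rule.dropNNeg (r : Rule α) : Rule α :=
  ⟨r.head, r.body.filter fun l => ¬ (l = .nneg l.atom ∧ Lit.pos l.atom ∈ r.body)⟩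

/-- Remove `a` from the head whenever `not a` is in the body. -/
def Rule.dropHead (r : Rule α) : Rule α :=
  ⟨r.head.filter fun a => Lit.neg a ∉ r.body, r.body⟩

/-- Minimality of a rule in a program. -/
def MinimalIn (P : Program α) (r : Rule α) : Prop :=
  ¬ ∃ r' ∈ P, (r'.head ⊆ r.head ∧ r'.body ⊂ r.body) ∨ (r'.head ⊂ r.head ∧ r'.body ⊆ r.body)

instance (P : Program α) (r : Rule α) : Decidable (MinimalIn P r) := by
  unfold MinimalIn; infer_instance

/-- The program obtained by the first three steps of the normal form construction. -/
def preNF (P : Program α) : Program α :=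
  ((P.filter fun r => ¬ r.Tautological).image Rule.dropNNeg).image Rule.dropHead

/-- The normal form `NF(P)`. -/
def NF (P : Program α) : Program α := (preNF P).filter fun r => MinimalIn (preNF P) r

end NormalForm

/-! ### The syntactic operator -/

section SyntacticOperator

variable {α : Type*} [DecidableEq α]

/-- The as-dual of a set of rules `P`: for every partition `⟨F, P \ F⟩` of `P`, choose a body
literal not on `q` from each rule of `F` and a head atom other than `q` from each rule of `P \ F`,
and collect the negations of the former and the double negations of the latter. -/
def asDual (q : α) (P : Program α) : Finset (Finset (Lit α)) :=
  P.powerset.biUnion fun F =>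
    (F.pi (fun r => r.bodyWo q) ×ˢ (P \ F).pi (fun r => r.headWo q)).image fun c =>
      notLits (F.attach.image fun r => c.1 r.1 r.2) ∪
        notnots ((P \ F).attach.image fun r => c.2 r.1 r.2)

/-- The rules not mentioning `q`. -/
def R (q : α) (P : Program α) : Program α := P.filter fun r => q ∉ r.sig

def R0 (q : α) (P : Program α) : Program α := P.filter fun r => Lit.pos q ∈ r.body

def R1 (q : α) (P : Program α) : Program α := P.filter fun r => Lit.neg q ∈ r.body

def R2 (q : α) (P : Program α) : Program α :=
  P.filter fun r => Lit.nneg q ∈ r.body ∧ q ∉ r.head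

def R3 (q : α) (P : Program α) : Program α :=
  P.filter fun r => Lit.nneg q ∈ r.body ∧ q ∈ r.head

def R4 (q : α) (P : Program α) : Program α :=
  P.filter fun r => Lit.nneg q ∉ r.body ∧ q ∈ r.head

def rules1a (q : α) (P : Program α) : Program α :=
  (R0 q P).biUnion fun r₀ => (R4 q P).image fun r₄ =>
    ⟨r₀.head ∪ r₄.headWo q, r₀.bodyWo q ∪ r₄.body⟩

def rules2a (q : α) (P : Program α) : Program α :=
  (R0 q P).biUnion fun r₀ => (R3 q P).biUnion fun r₃ => (R1 q P ∪ R4 q P).image fun r' =>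
    ⟨r₀.head ∪ r₃.headWo q,
      r₀.bodyWo q ∪ r₃.bodyWo q ∪ nots (r'.headWo q) ∪ notnotLits (r'.bodyWo q)⟩

def rules3a (q : α) (P : Program α) : Program α :=
  (R0 q P).biUnion fun r₀ => (R3 q P).biUnion fun r₃ => r₀.head.biUnion fun h =>
    (asDual q ((R0 q P ∪ R2 q P) \ {r₀})).image fun D =>
      ⟨r₀.head, r₀.bodyWo q ∪ {Lit.nneg h} ∪ D ∪ r₃.bodyWo q ∪ nots (r₃.headWo q)⟩

def rules1b (q : α) (P : Program α) : Program α :=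
  (R2 q P).biUnion fun r₂ => (R4 q P).image fun r₄ =>
    ⟨r₂.head, r₂.bodyWo q ∪ nots (r₄.headWo q) ∪ notnotLits r₄.body⟩

def rules2b (q : α) (P : Program α) : Program α :=
  (R2 q P).biUnion fun r₂ => (R3 q P).biUnion fun r₃ => (R1 q P ∪ R4 q P).image fun r' =>
    ⟨r₂.head,
      r₂.bodyWo q ∪ nots (r₃.headWo q ∪ r'.headWo q) ∪ notnotLits (r₃.bodyWo q ∪ r'.bodyWo q)⟩

def rules3b (q : α) (P : Program α) : Program α :=
  (R2 q P).biUnion fun r₂ => (R3 q P).biUnion fun r₃ => r₂.head.biUnion fun h =>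
    (asDual q ((R0 q P ∪ R2 q P) \ {r₂})).image fun D =>
      ⟨r₂.head, r₂.bodyWo q ∪ nots (r₃.headWo q) ∪ notnotLits (r₃.bodyWo q ∪ {Lit.pos h}) ∪ D⟩

def rules4 (q : α) (P : Program α) : Program α :=
  (R1 q P ∪ R4 q P).biUnion fun r' =>
    ((asDual q (R3 q P ∪ R4 q P)).filter fun D => D ∩ notLits (r'.bodyWo q) = ∅).image fun D =>
      ⟨r'.headWo q, r'.bodyWo q ∪ D⟩

def rules5 (q : α) (P : Program α) : Program α :=
  (R1 q P ∪ R4 q P).biUnion fun r' => (R3 q P).biUnion fun r₃ => (R0 q P ∪ R2 q P).biUnion fun r =>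
    ((asDual q (R4 q P)).filter fun D => D ∩ notLits (r'.bodyWo q) = ∅).image fun D =>
      ⟨r'.headWo q,
        r'.bodyWo q ∪ nots (r.head ∪ r₃.headWo q) ∪ notnotLits (r.bodyWo q ∪ r₃.bodyWo q) ∪ D⟩

/-- The head atom `h` is chosen different from `q`, so that the rules do not mention `q`. -/
def rules6 (q : α) (P : Program α) : Program α :=
  (R1 q P ∪ R4 q P).biUnion fun r' => (R3 q P).biUnion fun r₃ => (r'.headWo q).biUnion fun h =>
    (asDual q ((R1 q P ∪ R4 q P) \ {r'})).image fun D =>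
      ⟨r'.headWo q,
        r'.bodyWo q ∪ nots (r₃.headWo q) ∪ notnotLits (r₃.bodyWo q ∪ {Lit.pos h}) ∪ D⟩

def rules7 (q : α) (P : Program α) : Program α :=
  (R0 q P).biUnion fun r₀ => (R3 q P).biUnion fun r₃ => (R3 q P \ {r₃}).biUnion fun r₃' =>
    r₀.head.biUnion fun h => (asDual q ((R0 q P ∪ R2 q P) \ {r₀})).image fun D =>
      ⟨r₀.head ∪ r₃.headWo q,
        r₀.bodyWo q ∪ r₃.bodyWo q ∪ nots (r₃'.headWo q) ∪
          notnotLits (r₃'.bodyWo q ∪ {Lit.pos h}) ∪ D⟩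

/-- All rules derived from a program that is already in normal form. -/
def derived (q : α) (P : Program α) : Program α :=
  R q P ∪ rules1a q P ∪ rules2a q P ∪ rules3a q P ∪ rules1b q P ∪ rules2b q P ∪ rules3b q P ∪
    rules4 q P ∪ rules5 q P ∪ rules6 q P ∪ rules7 q P

/-- The result `f_SP(P, q)` of forgetting about `q` from `P`. -/
def fSP (P : Program α) (q : α) : Program α := NF (derived q (NF P))

/-- `f_SP` as a partial function on pairs of a program and a set of atoms, defined at `(P, V)`
exactly if `V` is a singleton `{q}`, where its value is `f_SP(P, q)`. -/
noncomputable def fSPOp (α : Type*) [DecidableEq α] : Program α × Set α →. Program α :=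
  fun PV => ⟨∃ q, PV.2 = {q}, fun h => fSP PV.1 h.choose⟩

theorem mem_fSPOp (P P' : Program α) (V : Set α) :
    P' ∈ fSPOp α (P, V) ↔ ∃ q, V = {q} ∧ P' = fSP P q := by
  constructor
  · rintro ⟨h, rfl⟩
    exact ⟨h.choose, h.choose_spec, rfl⟩
  · rintro ⟨q, rfl, rfl⟩
    have h : ∃ q', ({q} : Set α) = {q'} := ⟨q, rfl⟩
    have e : h.choose = q := (Set.singleton_eq_singleton_iff.mp h.choose_spec).symm
    exact ⟨h, congrArg (fSP P) e⟩

end SyntacticOperator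

end ASP

namespace ASP

/-! ### HT-satisfaction of literals, bodies and rules. -/

section Satisfaction

variable {α : Type*}

/-! Put $N = NF(P)$ and write $r^{\setminus q}$ for the rule $r$ with all occurrences of $q$ deleted
(`Rule.wo`). The normal form keeps the HT-models and leaves so few ways for $q$ to occur in a rule
that $N$ splits into the classes $R, R_0, \dots, R_4$. Fix $X \subseteq Y$ not containing $q$. Each
of $\langle X,Y\rangle$, $\langle X,Y\cup\{q\}\rangle$, $\langle X\cup\{q\},Y\cup\{q\}\rangle$
trivially satisfies the rules of some classes, and it satisfies any other rule $r$ iff $\langle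
X,Y\rangle$ satisfies $r^{\setminus q}$. The classes left are, besides $R$: $R_1\cup R_4$ for the
first, $R_2\cup R_3\cup R_4$ for the second, $R_0\cup R_2$ for the third (`ReducedAt.hSat_iff` and
its two variants).

So both sides of the claim become statements about which $r^{\setminus q}$ hold at $\langle
X,Y\rangle$ and at $\langle Y,Y\rangle$. On the semantic side, only $\emptyset$ and $\{q\}$ can be
relevant: $\emptyset$ if $R$ and $R_1\cup R_4$ hold at $\langle Y,Y\rangle$, and $\{q\}$ if $R$ and
$R_0\cup R_2$ hold there but $R_3\cup R_4$ does not (`mem_interRY_singleton`). On the syntactic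
side, a derived rule is a disjunction of such facts: joining bodies and heads gives "or" at $\langle
X,Y\rangle$, adding $not(H)\cup not\,not(B)$ gives "or" at $\langle Y,Y\rangle$, and letting $D$
range over the as-dual of $Q$ adds the premise that all of $Q$ holds at $\langle Y,Y\rangle$
(`exists_asDual_bodySat`).

The comparison has two stages: `hSat_derived_self` shows that the derived rules hold at $\langle
Y,Y\rangle$ iff $R$ does and one of the two relevance conditions is met, and `hSat_derived_of_total`
treats $X$ once such a condition is met. Uniqueness follows because $\mathsf F_{SP}$ prescribes the
HT-models over $\Sigma(P)\setminus\{q\}$, which contains the signatures of both results, and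
satisfaction depends only on the atoms that occur (`HT_eq_of_HT_eq`). -/

@[simp]
theorem Lit.atom_pos (a : α) : (Lit.pos a).atom = a := rfl

@[simp]
theorem Lit.atom_neg (a : α) : (Lit.neg a).atom = a := rfl

@[simp]
theorem Lit.atom_nneg (a : α) : (Lit.nneg a).atom = a := rfl

/-- Satisfaction of a literal by the HT-interpretation `⟨X, Y⟩`. -/
def Lit.HSat (X Y : Set α) : Lit α → Prop
  | .pos a => a ∈ X
  | .neg a => a ∉ Y
  | .nneg a => a ∈ Y

/-- Satisfaction of all literals of `B` by the HT-interpretation `⟨X, Y⟩`. -/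
def BodySat (X Y : Set α) (B : Finset (Lit α)) : Prop := ∀ l ∈ B, l.HSat X Y

/-- Satisfaction of some atom of `H` by `X`. -/
def HeadSat (X : Set α) (H : Finset α) : Prop := ∃ a ∈ H, a ∈ X

/-- Satisfaction of the reduct of a rule with respect to `Y` by `X`. -/
def Rule.HSat (X Y : Set α) (r : Rule α) : Prop := BodySat X Y r.body → HeadSat X r.head

theorem bodySat_iff {X Y : Set α} {B : Finset (Lit α)} :
    BodySat X Y B ↔ (∀ a, Lit.pos a ∈ B → a ∈ X) ∧ (∀ a, Lit.neg a ∈ B → a ∉ Y) ∧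
      ∀ a, Lit.nneg a ∈ B → a ∈ Y := by
  constructor
  · intro h
    exact ⟨fun a ha => h _ ha, fun a ha => h _ ha, fun a ha => h _ ha⟩
  · rintro ⟨h1, h2, h3⟩ (a | a | a) hl
    exacts [h1 a hl, h2 a hl, h3 a hl]

theorem Rule.sat_iff_hSat {Y : Set α} {r : Rule α} : r.Sat Y ↔ r.HSat Y Y := by
  simp only [Rule.Sat, Rule.HSat, bodySat_iff, HeadSat, and_imp]

theorem BodySat.mono {X Y : Set α} {B : Finset (Lit α)} (hXY : X ⊆ Y) (h : BodySat X Y B) :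
    BodySat Y Y B := by
  rw [bodySat_iff] at h ⊢
  exact ⟨fun a ha => hXY (h.1 a ha), h.2⟩

theorem HeadSat.mono {X Y : Set α} {H : Finset α} (hXY : X ⊆ Y) (h : HeadSat X H) :
    HeadSat Y H := by
  obtain ⟨a, ha, hX⟩ := h
  exact ⟨a, ha, hXY hX⟩

@[simp]
theorem bodySat_singleton {X Y : Set α} {l : Lit α} : BodySat X Y {l} ↔ l.HSat X Y := by
  simp [BodySat]

@[simp]
theorem Lit.hSat_naf {X Y : Set α} {l : Lit α} : l.naf.HSat X Y ↔ ¬ l.HSat Y Y := by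
  cases l <;> simp [Lit.naf, Lit.HSat]

@[simp]
theorem Lit.hSat_nafnaf {X Y : Set α} {l : Lit α} : l.nafnaf.HSat X Y ↔ l.HSat Y Y := by
  cases l <;> simp [Lit.nafnaf, Lit.HSat]

theorem Rule.HSat.of_subset {X Y : Set α} {r r' : Rule α} (hh : r'.head ⊆ r.head)
    (hb : r'.body ⊆ r.body) (h : r'.HSat X Y) : r.HSat X Y := fun hB => by
  obtain ⟨a, ha, hX⟩ := h fun l hl => hB l (hb hl)
  exact ⟨a, hh ha, hX⟩

variable [DecidableEq α]

@[simp]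
theorem bodySat_union {X Y : Set α} {B C : Finset (Lit α)} :
    BodySat X Y (B ∪ C) ↔ BodySat X Y B ∧ BodySat X Y C := by
  simp only [BodySat, Finset.mem_union, or_imp, forall_and]

@[simp]
theorem headSat_union {X : Set α} {H K : Finset α} :
    HeadSat X (H ∪ K) ↔ HeadSat X H ∨ HeadSat X K := by
  simp only [HeadSat, Finset.mem_union, or_and_right, exists_or]

@[simp]
theorem bodySat_nots {X Y : Set α} {H : Finset α} : BodySat X Y (nots H) ↔ ¬ HeadSat Y H := by
  simp [BodySat, nots, HeadSat, Lit.HSat]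

@[simp]
theorem bodySat_notnots {X Y : Set α} {H : Finset α} :
    BodySat X Y (notnots H) ↔ ∀ a ∈ H, a ∈ Y := by
  simp [BodySat, notnots, Lit.HSat]

@[simp]
theorem bodySat_notLits {X Y : Set α} {B : Finset (Lit α)} :
    BodySat X Y (notLits B) ↔ ∀ l ∈ B, ¬ l.HSat Y Y := by
  simp [BodySat, notLits]

@[simp]
theorem bodySat_notnotLits {X Y : Set α} {B : Finset (Lit α)} :
    BodySat X Y (notnotLits B) ↔ BodySat Y Y B := by
  simp [BodySat, notnotLits]

theorem Rule.sat_posPart {X : Set α} {r : Rule α} :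
    r.posPart.Sat X ↔ ((∀ a, Lit.pos a ∈ r.body → a ∈ X) → HeadSat X r.head) := by
  simp [Rule.posPart, Rule.Sat, HeadSat]

/-- Negated and doubly negated literals are evaluated at $Y$ when the reduct is formed, positive
ones at $X$ afterwards; evaluating all of them at once at $\langle X,Y\rangle$ removes the reduct
from the rest of the proof. -/
theorem models_reduct_iff {X Y : Set α} {P : Program α} :
    Models X (reduct P Y) ↔ ∀ r ∈ P, r.HSat X Y := by
  constructor
  · intro h r hr hb
    rw [bodySat_iff] at hb
    exact Rule.sat_posPart.1 (h _ ⟨r, hr, hb.2.1, hb.2.2, rfl⟩) hb.1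
  · rintro h _ ⟨r, hr, h1, h2, rfl⟩
    exact Rule.sat_posPart.2 fun h0 => h r hr (bodySat_iff.2 ⟨h0, h1, h2⟩)

theorem mem_HT_iff {X Y S : Set α} {P : Program α} :
    (X, Y) ∈ HT S P ↔ X ⊆ Y ∧ Y ⊆ S ∧ (∀ r ∈ P, r.HSat Y Y) ∧ ∀ r ∈ P, r.HSat X Y := by
  rw [← models_reduct_iff (X := X), HT]
  simp only [← Rule.sat_iff_hSat]
  rfl

/-- Satisfaction of a rule only depends on the atoms occurring in it. -/
theorem Rule.hSat_inter {X Y T : Set α} {r : Rule α} (hT : (↑r.sig : Set α) ⊆ T) :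
    r.HSat (X ∩ T) (Y ∩ T) ↔ r.HSat X Y := by
  have hh : ∀ a ∈ r.head, a ∈ T := fun a ha => hT (by simp [Rule.sig, ha])
  have hb : ∀ l ∈ r.body, l.atom ∈ T := fun l hl =>
    hT (by
      simp only [Rule.sig, Finset.coe_union, Set.mem_union, Finset.mem_coe, Finset.mem_image]
      exact Or.inr ⟨l, hl, rfl⟩)
  have h1 : HeadSat (X ∩ T) r.head ↔ HeadSat X r.head :=
    exists_congr fun a => and_congr_right fun ha => by simp [hh a ha]
  have h2 : BodySat (X ∩ T) (Y ∩ T) r.body ↔ BodySat X Y r.body := by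
    refine forall₂_congr fun l hl => ?_
    have := hb l hl
    cases l <;> simp_all [Lit.HSat, Lit.atom]
  simp only [Rule.HSat, h1, h2]

theorem sig_subset_iff {P : Program α} {T : Set α} :
    (↑(sig P) : Set α) ⊆ T ↔ ∀ r ∈ P, (↑r.sig : Set α) ⊆ T := by
  simp [sig]

/-- The HT-models over any set of atoms are determined by those over a superset of the
signature. -/
theorem mem_HT_iff_inter {X Y S T : Set α} {P : Program α} (hT : (↑(sig P) : Set α) ⊆ T) :
    (X, Y) ∈ HT S P ↔ X ⊆ Y ∧ Y ⊆ S ∧ (X ∩ T, Y ∩ T) ∈ HT T P := by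
  rw [sig_subset_iff] at hT
  have h : ∀ Z, (∀ r ∈ P, r.HSat (Z ∩ T) (Y ∩ T)) ↔ ∀ r ∈ P, r.HSat Z Y := fun Z =>
    forall₂_congr fun r hr => Rule.hSat_inter (hT r hr)
  simp only [mem_HT_iff, h]
  have h1 : X ⊆ Y → X ∩ T ⊆ Y ∩ T := fun h => Set.inter_subset_inter_left _ h
  have h2 : Y ∩ T ⊆ T := Set.inter_subset_right
  tauto

theorem HT_eq_of_HT_eq {P Q : Program α} {T : Set α} (hP : (↑(sig P) : Set α) ⊆ T)
    (hQ : (↑(sig Q) : Set α) ⊆ T) (h : HT T P = HT T Q) (S : Set α) : HT S P = HT S Q := by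
  ext ⟨X, Y⟩
  rw [mem_HT_iff_inter hP, mem_HT_iff_inter hQ, h]

end Satisfaction

/-! ### The normal form: preservation of HT-models and the possible occurrences of $q$. -/

section NormalForm

variable {α : Type*} [DecidableEq α]

theorem Rule.Tautological.hSat {X Y : Set α} {r : Rule α} (hXY : X ⊆ Y) (h : r.Tautological) :
    r.HSat X Y := by
  intro hb
  rw [bodySat_iff] at hb
  rcases h with ⟨a, ha, h⟩ | ⟨a, -, h, h'⟩ | ⟨a, -, h, h'⟩
  · exact ⟨a, ha, hb.1 a h⟩
  · exact absurd (hXY (hb.1 a h)) (hb.2.1 a h')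
  · exact absurd (hb.2.2 a h') (hb.2.1 a h)

theorem Rule.hSat_dropNNeg {X Y : Set α} {r : Rule α} (hXY : X ⊆ Y) :
    r.dropNNeg.HSat X Y ↔ r.HSat X Y := by
  have : BodySat X Y r.dropNNeg.body ↔ BodySat X Y r.body := by
    simp only [bodySat_iff, Rule.dropNNeg, Finset.mem_filter]
    constructor
    · rintro ⟨h1, h2, h3⟩
      refine ⟨fun a ha => h1 a ⟨ha, by simp⟩, fun a ha => h2 a ⟨ha, by simp⟩, fun a ha => ?_⟩
      by_cases hp : Lit.pos a ∈ r.body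
      · exact hXY (h1 a ⟨hp, by simp⟩)
      · exact h3 a ⟨ha, by simp [hp]⟩
    · rintro ⟨h1, h2, h3⟩
      exact ⟨fun a ha => h1 a ha.1, fun a ha => h2 a ha.1, fun a ha => h3 a ha.1⟩
  simp only [Rule.HSat, this]
  rfl

theorem Rule.hSat_dropHead {X Y : Set α} {r : Rule α} (hXY : X ⊆ Y) :
    r.dropHead.HSat X Y ↔ r.HSat X Y := by
  refine imp_congr_right fun hb => exists_congr fun a => ?_
  have hb' := (bodySat_iff.1 hb).2.1 a
  simp only [Rule.dropHead, Finset.mem_filter]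
  constructor
  · exact fun h => ⟨h.1.1, h.2⟩
  · exact fun h => ⟨⟨h.1, fun hn => hb' hn (hXY h.2)⟩, h.2⟩

theorem forall_mem_preNF {p : Rule α → Prop} {P : Program α} :
    (∀ r ∈ preNF P, p r) ↔ ∀ r ∈ P, ¬ r.Tautological → p r.dropNNeg.dropHead := by
  simp only [preNF, Finset.forall_mem_image, Finset.mem_filter, and_imp]

theorem hSat_preNF {X Y : Set α} {P : Program α} (hXY : X ⊆ Y) :
    (∀ r ∈ preNF P, r.HSat X Y) ↔ ∀ r ∈ P, r.HSat X Y := by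
  rw [forall_mem_preNF]
  refine forall₂_congr fun r _ => ?_
  rw [Rule.hSat_dropHead hXY, Rule.hSat_dropNNeg hXY]
  exact ⟨fun h => (em r.Tautological).elim (fun ht => ht.hSat hXY) h, fun h _ => h⟩

/-- A rule that is not minimal is subsumed by a strictly smaller one, so descent on the number of
head atoms plus body literals ends at a minimal rule. Hence step (4) of the normal form discards
only entailed rules. -/
theorem exists_minimalIn (P : Program α) (r : Rule α) (hr : r ∈ P) :
    ∃ r' ∈ P, MinimalIn P r' ∧ r'.head ⊆ r.head ∧ r'.body ⊆ r.body := by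
  induction hn : r.head.card + r.body.card using Nat.strong_induction_on generalizing r with
  | _ n ih =>
    by_cases hm : MinimalIn P r
    · exact ⟨r, hr, hm, subset_rfl, subset_rfl⟩
    · obtain ⟨s, hs, h⟩ := not_not.1 hm
      have key : s.head ⊆ r.head ∧ s.body ⊆ r.body ∧
          s.head.card + s.body.card < r.head.card + r.body.card := by
        rcases h with ⟨h1, h2⟩ | ⟨h1, h2⟩
        · exact ⟨h1, h2.subset, add_lt_add_of_le_of_lt (Finset.card_le_card h1)
            (Finset.card_lt_card h2)⟩
        · exact ⟨h1.subset, h2, add_lt_add_of_lt_of_le (Finset.card_lt_card h1)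
            (Finset.card_le_card h2)⟩
      obtain ⟨u, hu, hum, h1, h2⟩ := ih _ (hn ▸ key.2.2) s hs rfl
      exact ⟨u, hu, hum, h1.trans key.1, h2.trans key.2.1⟩

/-- The normal form has the same HT-models. -/
theorem hSat_NF {X Y : Set α} {P : Program α} (hXY : X ⊆ Y) :
    (∀ r ∈ NF P, r.HSat X Y) ↔ ∀ r ∈ P, r.HSat X Y := by
  rw [← hSat_preNF (P := P) hXY]
  constructor
  · intro h r hr
    obtain ⟨s, hs, hm, h1, h2⟩ := exists_minimalIn _ r hr
    exact (h s (Finset.mem_filter.2 ⟨hs, hm⟩)).of_subset h1 h2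
  · exact fun h r hr => h r (Finset.mem_filter.1 hr).1

theorem mem_HT_NF {X Y S : Set α} {P : Program α} : (X, Y) ∈ HT S (NF P) ↔ (X, Y) ∈ HT S P := by
  rw [mem_HT_iff, mem_HT_iff, hSat_NF subset_rfl]
  exact and_congr_right fun hXY => by rw [hSat_NF hXY]

theorem sig_NF_subset (P : Program α) : sig (NF P) ⊆ sig P := by
  have h : ∀ r ∈ preNF P, r.sig ⊆ sig P := by
    rw [forall_mem_preNF]
    intro r hr _
    refine subset_trans ?_ (Finset.subset_biUnion_of_mem Rule.sig hr)
    exact Finset.union_subset_union (Finset.filter_subset _ _)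
      (Finset.image_subset_image (Finset.filter_subset _ _))
  exact Finset.biUnion_subset.2 fun r hr => h r (Finset.mem_filter.1 hr).1

/-- No rule of the program is trivially simplifiable with respect to the atom `q`. -/
def ReducedAt (q : α) (P : Program α) : Prop :=
  ∀ r ∈ P, (Lit.pos q ∈ r.body → q ∉ r.head ∧ Lit.neg q ∉ r.body ∧ Lit.nneg q ∉ r.body) ∧
    (Lit.neg q ∈ r.body → q ∉ r.head ∧ Lit.nneg q ∉ r.body)

/-- Tautology removal excludes the pairs $q$ in head and body, $q$ with $not\,q$, and $not\,q$ with
$not\,not\,q$; steps (2) and (3) exclude $q$ with $not\,not\,q$, and $not\,q$ with $q$ in the head.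
The only double occurrence left is $not\,not\,q$ with $q$ in the head, which is the class $R_3$. -/
theorem reducedAt_NF (q : α) (P : Program α) : ReducedAt q (NF P) := by
  have key : ReducedAt q (preNF P) := by
    refine forall_mem_preNF.2 fun r _ ht => ?_
    have hs : ∀ l ∈ r.body, l.atom ∈ r.sig := fun l hl =>
      Finset.mem_union_right _ (Finset.mem_image_of_mem _ hl)
    simp only [Rule.Tautological, not_or, not_exists, not_and] at ht
    obtain ⟨h1, h2, h3⟩ := ht
    have h1 := h1 q
    have h2 := h2 q
    have h3 := h3 q
    have h4 := hs (.pos q)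
    have h5 := hs (.neg q)
    simp only [Rule.dropHead, Rule.dropNNeg, Finset.mem_filter,
      Lit.atom_pos, Lit.atom_neg, Lit.atom_nneg, reduceCtorEq, false_and, not_false_eq_true,
      and_true, true_and] at *
    tauto
  exact fun r hr => key r (Finset.mem_filter.1 hr).1

end NormalForm

/-! ### Deleting $q$ from a rule. -/

section Deletion

variable {α : Type*} {q : α} {X Y : Set α} {r : Rule α}

theorem Lit.hSat_insert_left {l : Lit α} (hl : l.atom ≠ q) :
    l.HSat (insert q X) Y ↔ l.HSat X Y := by
  cases l <;> simp_all [Lit.HSat]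

theorem Lit.hSat_insert_right {l : Lit α} (hl : l.atom ≠ q) :
    l.HSat X (insert q Y) ↔ l.HSat X Y := by
  cases l <;> simp_all [Lit.HSat]

variable [DecidableEq α]

/-- The rule `H^{∖q}(r) ← B^{∖q}(r)`. -/
def Rule.wo (q : α) (r : Rule α) : Rule α := ⟨r.headWo q, r.bodyWo q⟩

theorem headWo_eq (h : q ∉ r.head) : r.headWo q = r.head := Finset.erase_eq_of_notMem h

theorem bodyWo_eq (hp : Lit.pos q ∉ r.body) (hn : Lit.neg q ∉ r.body)
    (hnn : Lit.nneg q ∉ r.body) : r.bodyWo q = r.body := by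
  refine Finset.filter_true_of_mem ?_
  rintro (a | a | a) hl rfl
  exacts [hp hl, hn hl, hnn hl]

theorem bodySat_iff_bodyWo : BodySat X Y r.body ↔ BodySat X Y (r.bodyWo q) ∧
    (Lit.pos q ∈ r.body → q ∈ X) ∧ (Lit.neg q ∈ r.body → q ∉ Y) ∧
      (Lit.nneg q ∈ r.body → q ∈ Y) := by
  constructor
  · exact fun h => ⟨fun l hl => h l (Finset.mem_filter.1 hl).1, h _, h _, h _⟩
  · rintro ⟨h, hp, hn, hnn⟩ l hl
    by_cases hq : l.atom = q
    · subst hq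
      cases l
      exacts [hp hl, hn hl, hnn hl]
    · exact h l (Finset.mem_filter.2 ⟨hl, hq⟩)

theorem headSat_iff_headWo :
    HeadSat X r.head ↔ HeadSat X (r.headWo q) ∨ q ∈ r.head ∧ q ∈ X := by
  simp only [HeadSat, Rule.headWo, Finset.mem_erase]
  constructor
  · rintro ⟨a, ha, hX⟩
    by_cases hq : a = q
    · exact Or.inr (hq ▸ ⟨ha, hX⟩)
    · exact Or.inl ⟨a, ⟨hq, ha⟩, hX⟩
  · rintro (⟨a, ha, hX⟩ | h)
    exacts [⟨a, ha.2, hX⟩, ⟨q, h⟩]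

theorem headSat_insert_headWo : HeadSat (insert q X) (r.headWo q) ↔ HeadSat X (r.headWo q) :=
  exists_congr fun _ => and_congr_right fun ha =>
    Set.mem_insert_iff.trans (or_iff_right (Finset.mem_erase.1 ha).1)

theorem bodySat_insert_left :
    BodySat (insert q X) Y (r.bodyWo q) ↔ BodySat X Y (r.bodyWo q) :=
  forall₂_congr fun _ hl => Lit.hSat_insert_left (Finset.mem_filter.1 hl).2

theorem bodySat_insert_right :
    BodySat X (insert q Y) (r.bodyWo q) ↔ BodySat X Y (r.bodyWo q) :=
  forall₂_congr fun _ hl => Lit.hSat_insert_right (Finset.mem_filter.1 hl).2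

/-- Here and in the next two lemmas the position of $q$ fixes the truth of every occurrence of it. A
false body literal or a true head atom satisfies the rule outright; every other occurrence can be
deleted. -/
theorem Rule.hSat_iff_wo (hX : q ∉ X) (hY : q ∉ Y) : r.HSat X Y ↔
    (Lit.pos q ∉ r.body → Lit.nneg q ∉ r.body → (r.wo q).HSat X Y) := by
  simp only [Rule.HSat, Rule.wo, bodySat_iff_bodyWo (q := q), headSat_iff_headWo (q := q), hX, hY]
  tauto

theorem Rule.hSat_insert_right_iff_wo (hX : q ∉ X) : r.HSat X (insert q Y) ↔
    (Lit.pos q ∉ r.body → Lit.neg q ∉ r.body → (r.wo q).HSat X Y) := by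
  simp only [Rule.HSat, Rule.wo, bodySat_iff_bodyWo (q := q), headSat_iff_headWo (q := q), hX,
    bodySat_insert_right, Set.mem_insert_iff]
  tauto

theorem Rule.hSat_insert_iff_wo : r.HSat (insert q X) (insert q Y) ↔
    (Lit.neg q ∉ r.body → q ∉ r.head → (r.wo q).HSat X Y) := by
  simp only [Rule.HSat, Rule.wo, bodySat_iff_bodyWo (q := q), headSat_iff_headWo (q := q),
    bodySat_insert_right, bodySat_insert_left, headSat_insert_headWo, Set.mem_insert_iff]
  tauto

end Deletion

/-! ### The classes $R,R_0,\dots,R_4$ and the three positions of $q$. -/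

section Partition

variable {α : Type*} [DecidableEq α] {q : α} {N : Program α} {X Y : Set α} {r : Rule α}

theorem notMem_sig_iff : q ∉ r.sig ↔
    q ∉ r.head ∧ Lit.pos q ∉ r.body ∧ Lit.neg q ∉ r.body ∧ Lit.nneg q ∉ r.body := by
  simp only [Rule.sig, Finset.mem_union, Finset.mem_image, not_or, not_exists, not_and]
  refine and_congr_right fun _ => ⟨fun h => ?_, ?_⟩
  · exact ⟨fun h' => h _ h' rfl, fun h' => h _ h' rfl, fun h' => h _ h' rfl⟩
  · rintro ⟨hp, hn, hnn⟩ (a | a | a) hl rfl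
    exacts [hp hl, hn hl, hnn hl]

theorem wo_eq_of_notMem_sig (h : q ∉ r.sig) : r.wo q = r := by
  rw [notMem_sig_iff] at h
  rw [Rule.wo, headWo_eq h.1, bodyWo_eq h.2.1 h.2.2.1 h.2.2.2]

theorem ReducedAt.head_R0 (hN : ReducedAt q N) (hr : r ∈ R0 q N) : r.headWo q = r.head := by
  obtain ⟨h, h'⟩ := Finset.mem_filter.1 hr
  exact headWo_eq ((hN r h).1 h').1

theorem head_R2 (hr : r ∈ R2 q N) : r.headWo q = r.head :=
  headWo_eq (Finset.mem_filter.1 hr).2.2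

theorem ReducedAt.head_R0_union_R2 (hN : ReducedAt q N) (hr : r ∈ R0 q N ∪ R2 q N) :
    r.headWo q = r.head :=
  (Finset.mem_union.1 hr).elim hN.head_R0 head_R2

theorem ReducedAt.body_R4 (hN : ReducedAt q N) (hr : r ∈ R4 q N) : r.bodyWo q = r.body := by
  obtain ⟨h, h1, h2⟩ := Finset.mem_filter.1 hr
  exact bodyWo_eq (fun h' => ((hN r h).1 h').1 h2) (fun h' => ((hN r h).2 h').1 h2) h1

theorem ReducedAt.hSat_iff (hN : ReducedAt q N) (hX : q ∉ X) (hY : q ∉ Y) :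
    (∀ r ∈ N, r.HSat X Y) ↔ (∀ r ∈ R q N, (r.wo q).HSat X Y) ∧
      ∀ r ∈ R1 q N ∪ R4 q N, (r.wo q).HSat X Y := by
  rw [← forall_and]
  refine forall_congr' fun r => ?_
  have := hN r
  rw [Rule.hSat_iff_wo hX hY]
  simp only [R, R1, R4, Finset.mem_union, Finset.mem_filter, notMem_sig_iff]
  tauto

theorem ReducedAt.hSat_insert_right_iff (hN : ReducedAt q N) (hX : q ∉ X) :
    (∀ r ∈ N, r.HSat X (insert q Y)) ↔ (∀ r ∈ R q N, (r.wo q).HSat X Y) ∧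
      (∀ r ∈ R2 q N, (r.wo q).HSat X Y) ∧ ∀ r ∈ R3 q N ∪ R4 q N, (r.wo q).HSat X Y := by
  rw [← forall_and, ← forall_and]
  refine forall_congr' fun r => ?_
  have := hN r
  simp only [R, R2, R3, R4, Finset.mem_union, Finset.mem_filter, notMem_sig_iff,
    Rule.hSat_insert_right_iff_wo hX]
  tauto

theorem ReducedAt.hSat_insert_iff (hN : ReducedAt q N) :
    (∀ r ∈ N, r.HSat (insert q X) (insert q Y)) ↔ (∀ r ∈ R q N, (r.wo q).HSat X Y) ∧
      ∀ r ∈ R0 q N ∪ R2 q N, (r.wo q).HSat X Y := by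
  rw [← forall_and]
  refine forall_congr' fun r => ?_
  have := hN r
  simp only [R, R0, R2, Finset.mem_union, Finset.mem_filter, notMem_sig_iff,
    Rule.hSat_insert_iff_wo]
  tauto

end Partition

/-! ### What each family of derived rules says at $\langle X,Y\rangle$. -/

section Derived

variable {α : Type*} [DecidableEq α] {q : α} {N : Program α} {X Y : Set α}

theorem forall_mem_biUnion {β γ : Type*} [DecidableEq γ] {s : Finset β} {f : β → Finset γ}
    {p : γ → Prop} : (∀ c ∈ s.biUnion f, p c) ↔ ∀ b ∈ s, ∀ c ∈ f b, p c := by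
  simp only [Finset.mem_biUnion, forall_exists_index, and_imp]
  exact ⟨fun h b hb c hc => h c b hb hc, fun h c b hb hc => h b hb c hc⟩

/-- Some element of the as-dual holds if and only if all rules hold without `q`. -/
theorem exists_asDual_bodySat {Q : Program α} :
    (∃ D ∈ asDual q Q, BodySat X Y D) ↔ ∀ r ∈ Q, (r.wo q).HSat Y Y := by
  classical
  simp only [asDual, Finset.mem_biUnion, Finset.mem_image, Finset.mem_powerset,
    Finset.mem_product, Finset.mem_pi]
  constructor
  · rintro ⟨_, ⟨F, -, c, hc, rfl⟩, hD⟩ r hr hb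
    rw [bodySat_union, bodySat_notLits, bodySat_notnots] at hD
    by_cases hF : r ∈ F
    · exact absurd (hb _ (hc.1 r hF)) (hD.1 _ (Finset.mem_image_of_mem _ (F.mem_attach ⟨r, hF⟩)))
    · have hF' : r ∈ Q \ F := Finset.mem_sdiff.2 ⟨hr, hF⟩
      exact ⟨_, hc.2 r hF', hD.2 _ (Finset.mem_image_of_mem _ ((Q \ F).mem_attach ⟨r, hF'⟩))⟩
  · intro h
    -- The partition is dictated by $Y$: $F$ consists of the rules whose body fails at $\langle
    -- Y,Y\rangle$, which supply a false literal; the others supply a true head atom. Every literal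
    -- of $D$ is negated or doubly negated, so $X$ plays no role.
    have h1 : ∀ r ∈ Q.filter fun r => ¬ BodySat Y Y (r.bodyWo q),
        ∃ l ∈ r.bodyWo q, ¬ l.HSat Y Y := fun r hr => by
      simpa [BodySat] using (Finset.mem_filter.1 hr).2
    have h2 : ∀ r ∈ Q \ Q.filter fun r => ¬ BodySat Y Y (r.bodyWo q),
        ∃ a ∈ r.headWo q, a ∈ Y := fun r hr => by
      obtain ⟨hQ, hr⟩ := Finset.mem_sdiff.1 hr
      exact h r hQ (by_contra fun hb => hr (Finset.mem_filter.2 ⟨hQ, hb⟩))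
    choose l hl hl' using h1
    choose a ha ha' using h2
    refine ⟨_, ⟨_, Finset.filter_subset _ _, (l, a), ⟨hl, ha⟩, rfl⟩, ?_⟩
    rw [bodySat_union, bodySat_notLits, bodySat_notnots, Finset.forall_mem_image,
      Finset.forall_mem_image]
    exact ⟨fun r _ => hl' r.1 r.2, fun r _ => ha' r.1 r.2⟩

/-- The union of two bodies with the union of the heads expresses the disjunction of the two rules.
Reducedness makes $H(r_0)$ and $B(r_4)$ free of $q$, so the undeleted parts agree with the deleted
ones. -/
theorem hSat_rules1a (hN : ReducedAt q N) : (∀ r ∈ rules1a q N, r.HSat X Y) ↔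
    ∀ r₀ ∈ R0 q N, ∀ r₄ ∈ R4 q N, (r₀.wo q).HSat X Y ∨ (r₄.wo q).HSat X Y := by
  simp only [rules1a, forall_mem_biUnion, Finset.forall_mem_image]
  refine forall₄_congr fun r₀ h0 r₄ h4 => ?_
  simp only [Rule.HSat, Rule.wo, hN.head_R0 h0, hN.body_R4 h4, bodySat_union, headSat_union]
  tauto

theorem hSat_rules2a (hN : ReducedAt q N) : (∀ r ∈ rules2a q N, r.HSat X Y) ↔
    ∀ r₀ ∈ R0 q N, ∀ r₃ ∈ R3 q N, ∀ r' ∈ R1 q N ∪ R4 q N,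
      (r₀.wo q).HSat X Y ∨ (r₃.wo q).HSat X Y ∨ (r'.wo q).HSat Y Y := by
  simp only [rules2a, forall_mem_biUnion, Finset.forall_mem_image]
  refine forall₄_congr fun r₀ h0 r₃ _ => forall₂_congr fun r' _ => ?_
  simp only [Rule.HSat, Rule.wo, hN.head_R0 h0, bodySat_union, headSat_union, bodySat_nots,
    bodySat_notnotLits]
  tauto

theorem hSat_rules1b (hN : ReducedAt q N) : (∀ r ∈ rules1b q N, r.HSat X Y) ↔
    ∀ r₂ ∈ R2 q N, ∀ r₄ ∈ R4 q N, (r₂.wo q).HSat X Y ∨ (r₄.wo q).HSat Y Y := by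
  simp only [rules1b, forall_mem_biUnion, Finset.forall_mem_image]
  refine forall₄_congr fun r₂ h2 r₄ h4 => ?_
  simp only [Rule.HSat, Rule.wo, head_R2 h2, hN.body_R4 h4, bodySat_union, bodySat_nots,
    bodySat_notnotLits]
  tauto

theorem hSat_rules2b : (∀ r ∈ rules2b q N, r.HSat X Y) ↔
    ∀ r₂ ∈ R2 q N, ∀ r₃ ∈ R3 q N, ∀ r' ∈ R1 q N ∪ R4 q N,
      (r₂.wo q).HSat X Y ∨ (r₃.wo q).HSat Y Y ∨ (r'.wo q).HSat Y Y := by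
  simp only [rules2b, forall_mem_biUnion, Finset.forall_mem_image]
  refine forall₄_congr fun r₂ h2 r₃ _ => forall₂_congr fun r' _ => ?_
  simp only [Rule.HSat, Rule.wo, head_R2 h2, bodySat_union, headSat_union, bodySat_nots,
    bodySat_notnotLits]
  tauto

/-- Quantifying over the atoms of the head of a rule in rules guarded by the as-dual of the
remaining rules. -/
theorem forall_head_forall_asDual {Q : Program α} {r : Rule α} {p : Prop} (hXY : X ⊆ Y)
    (hr : r ∈ Q) :
    (∀ h ∈ r.headWo q, ∀ D ∈ asDual q (Q \ {r}),
      BodySat X Y (r.bodyWo q) → h ∈ Y → BodySat X Y D → HeadSat X (r.headWo q) ∨ p) ↔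
      ((∀ s ∈ Q, (s.wo q).HSat Y Y) → (r.wo q).HSat X Y ∨ p) := by
  -- $D$ speaks only of the rules other than $r$; the literal $not\,not\,h$ with $h$ in the head of
  -- $r$ accounts for $r$ itself, since once the body of $r$ holds, such an $h\in Y$ exists iff
  -- $r^{\setminus q}$ holds at $\langle Y,Y\rangle$.
  have key : (∀ s ∈ Q, (s.wo q).HSat Y Y) ↔
      (∀ s ∈ Q \ {r}, (s.wo q).HSat Y Y) ∧ (r.wo q).HSat Y Y := by
    constructor
    · exact fun h => ⟨fun s hs => h s (Finset.mem_sdiff.1 hs).1, h r hr⟩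
    · rintro ⟨h1, h2⟩ s hs
      by_cases hsr : s = r
      · exact hsr ▸ h2
      · exact h1 s (by simp [hs, hsr])
  rw [key, ← exists_asDual_bodySat (X := X)]
  constructor
  · rintro h ⟨⟨D, hD, hDs⟩, ht⟩
    by_cases hb : BodySat X Y (r.bodyWo q)
    · obtain ⟨a, ha, haY⟩ := ht (hb.mono hXY)
      exact (h a ha D hD hb haY hDs).imp_left fun h _ => h
    · exact Or.inl fun hb' => absurd hb' hb
  · intro h a ha D hD hb haY hDs
    exact (h ⟨⟨D, hD, hDs⟩, fun _ => ⟨a, ha, haY⟩⟩).imp_left fun h => h hb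

/-- The body of $r_3$ enters unchanged but its head enters negated, so the alternative is mixed:
body at $\langle X,Y\rangle$, head at $Y$. It is weaker than $r_3^{\setminus q}$ at $\langle
X,Y\rangle$ and than $r_3^{\setminus q}$ at $\langle Y,Y\rangle$. -/
theorem hSat_rules3a (hN : ReducedAt q N) (hXY : X ⊆ Y) : (∀ r ∈ rules3a q N, r.HSat X Y) ↔
    ∀ r₀ ∈ R0 q N, ∀ r₃ ∈ R3 q N, (∀ r ∈ R0 q N ∪ R2 q N, (r.wo q).HSat Y Y) →
      (r₀.wo q).HSat X Y ∨ (BodySat X Y (r₃.bodyWo q) → HeadSat Y (r₃.headWo q)) := by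
  simp only [rules3a, forall_mem_biUnion, Finset.forall_mem_image]
  refine forall₄_congr fun r₀ h0 r₃ _ => ?_
  rw [← forall_head_forall_asDual hXY (Finset.mem_union_left _ h0), hN.head_R0 h0]
  refine forall₄_congr fun a _ D _ => ?_
  simp only [Rule.HSat, bodySat_union, bodySat_singleton, Lit.HSat, bodySat_nots]
  tauto

theorem hSat_rules3b (hXY : X ⊆ Y) : (∀ r ∈ rules3b q N, r.HSat X Y) ↔
    ∀ r₂ ∈ R2 q N, ∀ r₃ ∈ R3 q N, (∀ r ∈ R0 q N ∪ R2 q N, (r.wo q).HSat Y Y) →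
      (r₂.wo q).HSat X Y ∨ (r₃.wo q).HSat Y Y := by
  simp only [rules3b, forall_mem_biUnion, Finset.forall_mem_image]
  refine forall₄_congr fun r₂ h2 r₃ _ => ?_
  rw [← forall_head_forall_asDual hXY (Finset.mem_union_right _ h2), head_R2 h2]
  refine forall₄_congr fun a _ D _ => ?_
  simp only [Rule.HSat, Rule.wo, bodySat_union, bodySat_singleton, Lit.HSat, bodySat_nots,
    bodySat_notnotLits]
  tauto

theorem hSat_rules6 (hXY : X ⊆ Y) : (∀ r ∈ rules6 q N, r.HSat X Y) ↔
    ∀ r' ∈ R1 q N ∪ R4 q N, ∀ r₃ ∈ R3 q N, (∀ r ∈ R1 q N ∪ R4 q N, (r.wo q).HSat Y Y) →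
      (r'.wo q).HSat X Y ∨ (r₃.wo q).HSat Y Y := by
  simp only [rules6, forall_mem_biUnion, Finset.forall_mem_image]
  refine forall₄_congr fun r' h' r₃ _ => ?_
  rw [← forall_head_forall_asDual hXY h']
  refine forall₄_congr fun a _ D _ => ?_
  simp only [Rule.HSat, Rule.wo, bodySat_union, bodySat_singleton, Lit.HSat, bodySat_nots,
    bodySat_notnotLits]
  tauto

theorem hSat_rules7 (hN : ReducedAt q N) (hXY : X ⊆ Y) : (∀ r ∈ rules7 q N, r.HSat X Y) ↔
    ∀ r₀ ∈ R0 q N, ∀ r₃ ∈ R3 q N, ∀ r₃' ∈ R3 q N \ {r₃},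
      (∀ r ∈ R0 q N ∪ R2 q N, (r.wo q).HSat Y Y) →
        (r₀.wo q).HSat X Y ∨ (r₃.wo q).HSat X Y ∨ (r₃'.wo q).HSat Y Y := by
  simp only [rules7, forall_mem_biUnion, Finset.forall_mem_image]
  refine forall₄_congr fun r₀ h0 r₃ _ => forall₂_congr fun r₃' _ => ?_
  rw [← forall_head_forall_asDual hXY (Finset.mem_union_left _ h0), hN.head_R0 h0]
  refine forall₄_congr fun a _ D _ => ?_
  simp only [Rule.HSat, Rule.wo, bodySat_union, bodySat_singleton, Lit.HSat, bodySat_nots,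
    bodySat_notnotLits, headSat_union]
  tauto

/-- Discarding the elements of the as-dual that contradict a body does not matter. -/
theorem forall_filter_asDual {Q : Program α} {r : Rule α} {p : Prop} (hXY : X ⊆ Y) :
    (∀ D ∈ (asDual q Q).filter fun D => D ∩ notLits (r.bodyWo q) = ∅,
      BodySat X Y (r.bodyWo q) → BodySat X Y D → HeadSat X (r.headWo q) ∨ p) ↔
      ((∀ s ∈ Q, (s.wo q).HSat Y Y) → (r.wo q).HSat X Y ∨ p) := by
  rw [← exists_asDual_bodySat (X := X)]
  constructor
  · rintro h ⟨D, hD, hDs⟩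
    by_cases hb : BodySat X Y (r.bodyWo q)
    · refine (h D (Finset.mem_filter.2 ⟨hD, ?_⟩) hb hDs).imp_left fun h _ => h
      -- A common literal would be the negation of a member of the body, which is true at $\langle
      -- Y,Y\rangle$ by persistence, so $D$ could not hold.
      refine Finset.eq_empty_of_forall_notMem fun l hl => ?_
      obtain ⟨hl1, hl2⟩ := Finset.mem_inter.1 hl
      obtain ⟨k, hk, rfl⟩ := Finset.mem_image.1 hl2
      exact Lit.hSat_naf.1 (hDs _ hl1) (hb.mono hXY k hk)
    · exact Or.inl fun hb' => absurd hb' hb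
  · intro h D hD hb hDs
    exact (h ⟨D, (Finset.mem_filter.1 hD).1, hDs⟩).imp_left fun h => h hb

theorem hSat_rules4 (hXY : X ⊆ Y) : (∀ r ∈ rules4 q N, r.HSat X Y) ↔
    ∀ r' ∈ R1 q N ∪ R4 q N, (∀ r ∈ R3 q N ∪ R4 q N, (r.wo q).HSat Y Y) →
      (r'.wo q).HSat X Y := by
  simp only [rules4, forall_mem_biUnion, Finset.forall_mem_image]
  refine forall₂_congr fun r' _ => ?_
  rw [← or_false ((r'.wo q).HSat X Y), ← forall_filter_asDual hXY]
  refine forall₂_congr fun D _ => ?_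
  simp only [Rule.HSat, bodySat_union]
  tauto

theorem hSat_rules5 (hN : ReducedAt q N) (hXY : X ⊆ Y) : (∀ r ∈ rules5 q N, r.HSat X Y) ↔
    ∀ r' ∈ R1 q N ∪ R4 q N, ∀ r₃ ∈ R3 q N, ∀ r ∈ R0 q N ∪ R2 q N,
      (∀ r ∈ R4 q N, (r.wo q).HSat Y Y) →
        (r'.wo q).HSat X Y ∨ (r.wo q).HSat Y Y ∨ (r₃.wo q).HSat Y Y := by
  simp only [rules5, forall_mem_biUnion, Finset.forall_mem_image]
  refine forall₄_congr fun r' _ r₃ _ => forall₂_congr fun r hr => ?_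
  rw [← forall_filter_asDual hXY]
  refine forall₂_congr fun D _ => ?_
  simp only [Rule.HSat, Rule.wo, bodySat_union, headSat_union, bodySat_nots, bodySat_notnotLits,
    hN.head_R0_union_R2 hr]
  tauto

end Derived

/-! ### Derived rules compared with the relevant extensions $\emptyset$ and $\{q\}$. -/

section Characterization

variable {α : Type*} [DecidableEq α] {q : α} {N P : Program α} {X Y S : Set α}

/-- Satisfaction of the derived rules in terms of the original rules without `q`. -/
theorem hSat_derived (hN : ReducedAt q N) (hXY : X ⊆ Y) :
    (∀ r ∈ derived q N, r.HSat X Y) ↔ (∀ r ∈ R q N, (r.wo q).HSat X Y) ∧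
      (∀ r₀ ∈ R0 q N, ∀ r₄ ∈ R4 q N, (r₀.wo q).HSat X Y ∨ (r₄.wo q).HSat X Y) ∧
      (∀ r₀ ∈ R0 q N, ∀ r₃ ∈ R3 q N, ∀ r' ∈ R1 q N ∪ R4 q N,
        (r₀.wo q).HSat X Y ∨ (r₃.wo q).HSat X Y ∨ (r'.wo q).HSat Y Y) ∧
      (∀ r₀ ∈ R0 q N, ∀ r₃ ∈ R3 q N, (∀ r ∈ R0 q N ∪ R2 q N, (r.wo q).HSat Y Y) →
        (r₀.wo q).HSat X Y ∨ (BodySat X Y (r₃.bodyWo q) → HeadSat Y (r₃.headWo q))) ∧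
      (∀ r₂ ∈ R2 q N, ∀ r₄ ∈ R4 q N, (r₂.wo q).HSat X Y ∨ (r₄.wo q).HSat Y Y) ∧
      (∀ r₂ ∈ R2 q N, ∀ r₃ ∈ R3 q N, ∀ r' ∈ R1 q N ∪ R4 q N,
        (r₂.wo q).HSat X Y ∨ (r₃.wo q).HSat Y Y ∨ (r'.wo q).HSat Y Y) ∧
      (∀ r₂ ∈ R2 q N, ∀ r₃ ∈ R3 q N, (∀ r ∈ R0 q N ∪ R2 q N, (r.wo q).HSat Y Y) →
        (r₂.wo q).HSat X Y ∨ (r₃.wo q).HSat Y Y) ∧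
      (∀ r' ∈ R1 q N ∪ R4 q N, (∀ r ∈ R3 q N ∪ R4 q N, (r.wo q).HSat Y Y) →
        (r'.wo q).HSat X Y) ∧
      (∀ r' ∈ R1 q N ∪ R4 q N, ∀ r₃ ∈ R3 q N, ∀ r ∈ R0 q N ∪ R2 q N,
        (∀ r ∈ R4 q N, (r.wo q).HSat Y Y) →
          (r'.wo q).HSat X Y ∨ (r.wo q).HSat Y Y ∨ (r₃.wo q).HSat Y Y) ∧
      (∀ r' ∈ R1 q N ∪ R4 q N, ∀ r₃ ∈ R3 q N, (∀ r ∈ R1 q N ∪ R4 q N, (r.wo q).HSat Y Y) →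
        (r'.wo q).HSat X Y ∨ (r₃.wo q).HSat Y Y) ∧
      (∀ r₀ ∈ R0 q N, ∀ r₃ ∈ R3 q N, ∀ r₃' ∈ R3 q N \ {r₃},
        (∀ r ∈ R0 q N ∪ R2 q N, (r.wo q).HSat Y Y) →
          (r₀.wo q).HSat X Y ∨ (r₃.wo q).HSat X Y ∨ (r₃'.wo q).HSat Y Y) := by
  have hR : (∀ r ∈ R q N, r.HSat X Y) ↔ ∀ r ∈ R q N, (r.wo q).HSat X Y :=
    forall₂_congr fun r hr => by rw [wo_eq_of_notMem_sig (Finset.mem_filter.1 hr).2]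
  rw [← hR, ← hSat_rules1a hN, ← hSat_rules2a hN, ← hSat_rules3a hN hXY, ← hSat_rules1b hN,
    ← hSat_rules2b, ← hSat_rules3b hXY, ← hSat_rules4 hXY, ← hSat_rules5 hN hXY,
    ← hSat_rules6 hXY, ← hSat_rules7 hN hXY]
  simp only [derived, Finset.forall_mem_union, and_assoc]

/-- The derived rules hold in the total interpretation `⟨Y, Y⟩` if and only if `Y` has a relevant
extension. -/
theorem hSat_derived_self (hN : ReducedAt q N) :
    (∀ r ∈ derived q N, r.HSat Y Y) ↔ (∀ r ∈ R q N, (r.wo q).HSat Y Y) ∧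
      ((∀ r ∈ R1 q N ∪ R4 q N, (r.wo q).HSat Y Y) ∨
        (∀ r ∈ R0 q N ∪ R2 q N, (r.wo q).HSat Y Y) ∧
          ¬ ∀ r ∈ R3 q N ∪ R4 q N, (r.wo q).HSat Y Y) := by
  rw [hSat_derived hN subset_rfl]
  refine and_congr_right fun _ => ?_
  constructor
  · rintro ⟨h1a, h2a, -, h1b, h2b, -, h4, h5, -⟩
    by_contra! ⟨⟨r', hr', ht'⟩, h⟩
    -- If neither extension is relevant, family (4) makes $R_3\cup R_4$ fail, hence $R_0\cup R_2$
    -- fails as well; a failing rule there forces $R_4$ by (1a) and (1b), then $R_3$ by (5), a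
    -- contradiction.
    have hE : ¬ ∀ r ∈ R3 q N ∪ R4 q N, (r.wo q).HSat Y Y := fun hE => ht' (h4 r' hr' hE)
    obtain ⟨r, hr, ht⟩ : ∃ r ∈ R0 q N ∪ R2 q N, ¬ (r.wo q).HSat Y Y := by
      by_contra! hA
      exact hE (h hA)
    have ht4 : ∀ r₄ ∈ R4 q N, (r₄.wo q).HSat Y Y := fun r₄ h₄ =>
      (Finset.mem_union.1 hr).elim (fun h₀ => (h1a r h₀ r₄ h₄).resolve_left ht)
        fun h₂ => (h1b r h₂ r₄ h₄).resolve_left ht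
    have ht3 : ∀ r₃ ∈ R3 q N, (r₃.wo q).HSat Y Y := fun r₃ h₃ =>
      ((h5 r' hr' r₃ h₃ r hr ht4).resolve_left ht').resolve_left ht
    exact hE (Finset.forall_mem_union.2 ⟨ht3, ht4⟩)
  · have hw : ∀ r : Rule α, (r.wo q).HSat Y Y →
      (BodySat Y Y (r.bodyWo q) → HeadSat Y (r.headWo q)) := fun _ h => h
    simp only [Finset.mem_union, Finset.mem_sdiff] at *
    rintro (h | ⟨h, hE⟩)
    · refine ⟨?_, ?_, ?_, ?_, ?_, ?_, ?_, ?_, ?_, ?_⟩ <;> grind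
    · refine ⟨?_, ?_, ?_, ?_, ?_, ?_, ?_, ?_, ?_, ?_⟩ <;> grind

/-- Given that `Y` has a relevant extension, the derived rules hold in `⟨X, Y⟩` if and only if
`X` belongs to the set given by every relevant extension. -/
theorem hSat_derived_of_total (hN : ReducedAt q N) (hXY : X ⊆ Y)
    (hT : (∀ r ∈ R1 q N ∪ R4 q N, (r.wo q).HSat Y Y) ∨
      (∀ r ∈ R0 q N ∪ R2 q N, (r.wo q).HSat Y Y) ∧
        ¬ ∀ r ∈ R3 q N ∪ R4 q N, (r.wo q).HSat Y Y) :
    (∀ r ∈ derived q N, r.HSat X Y) ↔ (∀ r ∈ R q N, (r.wo q).HSat X Y) ∧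
      ((∀ r ∈ R1 q N ∪ R4 q N, (r.wo q).HSat Y Y) →
        ∀ r ∈ R1 q N ∪ R4 q N, (r.wo q).HSat X Y) ∧
      ((∀ r ∈ R0 q N ∪ R2 q N, (r.wo q).HSat Y Y) →
        (¬ ∀ r ∈ R3 q N ∪ R4 q N, (r.wo q).HSat Y Y) →
          (∀ r ∈ R2 q N, (r.wo q).HSat X Y) ∧
            ((∀ r ∈ R3 q N ∪ R4 q N, (r.wo q).HSat X Y) ∨
              ∀ r ∈ R0 q N, (r.wo q).HSat X Y)) := by
  rw [hSat_derived hN hXY]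
  refine and_congr_right fun _ => ?_
  -- This yields the mixed alternative of family (3a) in the converse direction.
  have hw : ∀ r : Rule α, (r.wo q).HSat X Y ∨ (r.wo q).HSat Y Y →
      (BodySat X Y (r.bodyWo q) → HeadSat Y (r.headWo q)) := fun r h hb =>
    h.elim (fun h => (h hb).mono hXY) fun h => h (hb.mono hXY)
  constructor
  · rintro ⟨h1a, h2a, h3a, h1b, -, h3b, h4, -, h6, h7⟩
    refine ⟨fun hA r' hr' => ?_, fun hA hE => ⟨fun r₂ h₂ => ?_, ?_⟩⟩
    · by_cases hE : ∀ r ∈ R3 q N ∪ R4 q N, (r.wo q).HSat Y Y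
      · exact h4 r' hr' hE
      · push Not at hE
        obtain ⟨r, hr, ht⟩ := hE
        rcases Finset.mem_union.1 hr with h₃ | h₄
        · exact (h6 r' hr' r h₃ hA).resolve_right ht
        · exact absurd (hA r (Finset.mem_union_right _ h₄)) ht
    · push Not at hE
      obtain ⟨r, hr, ht⟩ := hE
      rcases Finset.mem_union.1 hr with h₃ | h₄
      · exact (h3b r₂ h₂ r h₃ hA).resolve_right ht
      · exact (h1b r₂ h₂ r h₄).resolve_right ht
    · rw [or_iff_not_imp_right]
      intro h0
      push Not at h0 hE
      obtain ⟨r₀, h₀, hn⟩ := h0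
      obtain ⟨r, hr, ht⟩ := hE
      refine Finset.forall_mem_union.2 ⟨fun r₃ h₃ => ?_, fun r₄ h₄ =>
        (h1a r₀ h₀ r₄ h₄).resolve_left hn⟩
      -- The rule $r$ failing at $\langle Y,Y\rangle$ decides which family gives $r_3$ at $\langle
      -- X,Y\rangle$: (2a) if $r\in R_4$, (7) if $r\in R_3$ differs from $r_3$, and (3a) if $r=r_3$.
      -- In the last case no head atom of $r_3$ other than $q$ is in $Y$, so (3a) makes its body
      -- false and $r_3$ holds vacuously.
      rcases Finset.mem_union.1 hr with h₃' | h₄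
      · by_cases hr₃ : r = r₃
        · subst hr₃
          have hwr := (h3a r₀ h₀ r h₃ hA).resolve_left hn
          intro hb
          exact absurd (fun _ => hwr hb) ht
        · exact ((h7 r₀ h₀ r₃ h₃ r (by simp [h₃', hr₃]) hA).resolve_left hn).resolve_right ht
      · exact ((h2a r₀ h₀ r₃ h₃ r (Finset.mem_union_right _ h₄)).resolve_left hn).resolve_right ht
  · rintro ⟨hA, hB⟩
    replace hB : (∀ r ∈ R0 q N ∪ R2 q N, (r.wo q).HSat Y Y) → ∀ s ∈ R3 q N ∪ R4 q N,
        ¬ (s.wo q).HSat Y Y → (∀ r ∈ R2 q N, (r.wo q).HSat X Y) ∧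
          ((∀ r ∈ R3 q N ∪ R4 q N, (r.wo q).HSat X Y) ∨ ∀ r ∈ R0 q N, (r.wo q).HSat X Y) :=
      fun h s hs hs' => hB h fun h' => hs' (h' s hs)
    simp only [Finset.mem_union, Finset.mem_sdiff] at *
    rcases hT with hT | ⟨h0, hE⟩
    · replace hA := hA hT
      by_cases h0 : ∀ r, r ∈ R0 q N ∨ r ∈ R2 q N → (r.wo q).HSat Y Y
      · replace hB := hB h0
        refine ⟨?_, ?_, ?_, ?_, ?_, ?_, ?_, ?_, ?_, ?_⟩ <;> grind
      -- Some rule of $R_0\cup R_2$ fails at $\langle Y,Y\rangle$, so families (3a), (3b) and (7),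
      -- which are guarded by all of these rules, hold vacuously.
      · clear hB
        refine ⟨?_, ?_, fun _ _ _ _ h => absurd h h0, ?_, ?_, fun _ _ _ _ h => absurd h h0, ?_, ?_,
          ?_, fun _ _ _ _ _ _ h => absurd h h0⟩ <;> grind
    · replace hB := hB h0
      refine ⟨?_, ?_, ?_, ?_, ?_, ?_, ?_, ?_, ?_, ?_⟩ <;> grind

/-- A singleton has only the relevant subsets `∅` and `{q}`. -/
theorem mem_interRY_singleton (hY : q ∉ Y) : X ∈ interRY P {q} Y ↔ q ∉ X ∧
    ((Y, Y) ∈ HT (↑(sig P)) P ∨ (insert q Y, insert q Y) ∈ HT (↑(sig P)) P ∧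
      (Y, insert q Y) ∉ HT (↑(sig P)) P) ∧
    ((Y, Y) ∈ HT (↑(sig P)) P → (X, Y) ∈ HT (↑(sig P)) P) ∧
    ((insert q Y, insert q Y) ∈ HT (↑(sig P)) P → (Y, insert q Y) ∉ HT (↑(sig P)) P →
      (X, insert q Y) ∈ HT (↑(sig P)) P ∨ (insert q X, insert q Y) ∈ HT (↑(sig P)) P) := by
  have hRel : ∀ A, A ∈ Rel P {q} Y ↔ A = ∅ ∧ (Y, Y) ∈ HT (↑(sig P)) P ∨
      A = {q} ∧ (insert q Y, insert q Y) ∈ HT (↑(sig P)) P ∧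
        (Y, insert q Y) ∉ HT (↑(sig P)) P := by
    intro A
    simp only [Rel, Set.mem_ofPred_eq]
    constructor
    · rintro ⟨h, h1, h2⟩
      rcases Set.subset_singleton_iff_eq.1 h with rfl | rfl
      · exact Or.inl ⟨rfl, by simpa using h1⟩
      · rw [Set.union_singleton] at h1 h2
        refine Or.inr ⟨rfl, h1, fun h3 => h2 ⟨∅, ?_, by simpa using h3⟩⟩
        exact (Set.singleton_nonempty q).empty_ssubset
    · rintro (⟨rfl, h⟩ | ⟨rfl, h1, h2⟩)
      · refine ⟨Set.empty_subset _, by simpa using h, ?_⟩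
        rintro ⟨A', hA, -⟩
        exact hA.2 (Set.empty_subset _)
      · rw [Set.union_singleton]
        refine ⟨subset_rfl, h1, ?_⟩
        rintro ⟨A', hA, h⟩
        rw [Set.ssubset_singleton_iff.1 hA, Set.union_empty] at h
        exact h2 h
  have h0 : X ∈ RYA P {q} Y ∅ ↔ q ∉ X ∧ (X, Y) ∈ HT (↑(sig P)) P := by
    simp only [RYA, Set.mem_ofPred_eq, Set.union_empty]
    constructor
    · rintro ⟨Z, hZ, rfl⟩
      have hq : q ∉ Z := fun h => hY ((mem_HT_iff.1 hZ).1 h)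
      rw [Set.sdiff_singleton_eq_self hq]
      exact ⟨hq, hZ⟩
    · rintro ⟨hq, h⟩
      exact ⟨X, h, (Set.sdiff_singleton_eq_self hq).symm⟩
  have h1 : X ∈ RYA P {q} Y {q} ↔ q ∉ X ∧
      ((X, insert q Y) ∈ HT (↑(sig P)) P ∨ (insert q X, insert q Y) ∈ HT (↑(sig P)) P) := by
    simp only [RYA, Set.mem_ofPred_eq, Set.union_singleton]
    constructor
    · rintro ⟨Z, hZ, rfl⟩
      refine ⟨fun h => h.2 rfl, ?_⟩
      by_cases hq : q ∈ Z
      · exact Or.inr (by rwa [Set.insert_sdiff_singleton, Set.insert_eq_of_mem hq])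
      · exact Or.inl (by rwa [Set.sdiff_singleton_eq_self hq])
    · rintro ⟨hq, h | h⟩
      · exact ⟨X, h, (Set.sdiff_singleton_eq_self hq).symm⟩
      · exact ⟨insert q X, h, by simp [hq]⟩
  have hmem : X ∈ interRY P {q} Y ↔ (∃ A, A ∈ Rel P {q} Y) ∧
      ∀ A ∈ Rel P {q} Y, X ∈ RYA P {q} Y A := by
    constructor
    · rintro ⟨⟨_, A, hA, -⟩, h⟩
      exact ⟨⟨A, hA⟩, fun A hA => h _ ⟨A, hA, rfl⟩⟩
    · rintro ⟨⟨A, hA⟩, h⟩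
      refine ⟨⟨_, A, hA, rfl⟩, ?_⟩
      rintro _ ⟨A, hA, rfl⟩
      exact h A hA
  simp only [hmem, hRel, exists_or, exists_eq_left, or_imp, forall_and, and_imp, forall_eq, h0, h1]
  clear hmem hRel h0 h1
  generalize HT (↑(sig P)) P = M
  -- For $q\in X$ both sides are false: some extension is relevant, and every set it contributes has
  -- $q$ removed.
  by_cases hX : q ∈ X
  · simp only [hX]
    tauto
  · simp only [hX, not_false_eq_true, true_and, implies_true]

/-- The HT-models of the normal form of the derived program are those required by `F_SP`. -/
theorem HT_fSP (P : Program α) (q : α) :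
    HT (↑(sig P) \ {q}) (fSP P q) =
      {I | I.2 ⊆ ↑(sig P) \ {q} ∧ I.1 ∈ interRY P {q} I.2} := by
  ext ⟨X, Y⟩
  simp only [Set.mem_ofPred_eq]
  by_cases hYS : Y ⊆ ↑(sig P) \ {q}
  swap
  · simp [hYS, mem_HT_iff]
  have hY : q ∉ Y := fun h => (hYS h).2 rfl
  have hYP : Y ⊆ ↑(sig P) := fun a ha => (hYS ha).1
  have hN := reducedAt_NF q P
  rw [fSP, mem_HT_NF, mem_interRY_singleton hY]
  -- Only the program is replaced by its normal form; the ambient set stays $\Sigma(P)$, which may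
  -- be larger than $\Sigma(NF(P))$.
  simp only [← mem_HT_NF (P := P)]
  have hYq : Y ⊆ insert q Y := Set.subset_insert q Y
  by_cases hXY : X ⊆ Y
  swap
  · refine iff_of_false (fun h => hXY (mem_HT_iff.1 h).1) ?_
    rintro ⟨-, hX, h | ⟨h1, h2⟩, h0, hq⟩
    · exact hXY (mem_HT_iff.1 (h0 h)).1
    · rcases hq h1 h2 with h | h
      · exact hXY ((Set.subset_insert_iff_of_notMem hX).1 (mem_HT_iff.1 h).1)
      · exact hXY ((Set.insert_subset_insert_iff hX).1 (mem_HT_iff.1 h).1)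
  have hX : q ∉ X := fun h => hY (hXY h)
  have hXq : X ⊆ insert q Y := hXY.trans hYq
  have hqq : insert q X ⊆ insert q Y := Set.insert_subset_insert hXY
  -- An interpretation containing $q$ counts only if $q\in\Sigma(P)$. This is automatic when $\{q\}$
  -- is to be relevant, because a failing rule of $R_3\cup R_4$ has $q$ in its head.
  have hq : (¬ ∀ r ∈ R3 q (NF P) ∪ R4 q (NF P), (r.wo q).HSat Y Y) → q ∈ sig P := by
    intro h
    push Not at h
    obtain ⟨r, hr, -⟩ := h
    have hr' : r ∈ NF P ∧ q ∈ r.head := by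
      simp only [R3, R4, Finset.mem_union, Finset.mem_filter] at hr
      tauto
    exact sig_NF_subset P (Finset.mem_biUnion.2 ⟨r, hr'.1, Finset.mem_union_left _ hr'.2⟩)
  simp only [mem_HT_iff, hXY, hYS, hYP, hYq, hXq, hqq, subset_rfl, true_and, Set.insert_subset_iff,
    and_true, hN.hSat_iff hX hY, hN.hSat_iff hY hY, hN.hSat_insert_iff,
    hN.hSat_insert_right_iff hX, hN.hSat_insert_right_iff hY, hSat_derived_self hN, hX,
    not_false_eq_true, Finset.mem_coe]
  have h02 : ∀ Z, (∀ r ∈ R0 q (NF P) ∪ R2 q (NF P), (r.wo q).HSat Z Y) ↔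
      (∀ r ∈ R0 q (NF P), (r.wo q).HSat Z Y) ∧ ∀ r ∈ R2 q (NF P), (r.wo q).HSat Z Y :=
    fun Z => Finset.forall_mem_union
  by_cases hT : (∀ r ∈ R1 q (NF P) ∪ R4 q (NF P), (r.wo q).HSat Y Y) ∨
      (∀ r ∈ R0 q (NF P) ∪ R2 q (NF P), (r.wo q).HSat Y Y) ∧
        ¬ ∀ r ∈ R3 q (NF P) ∪ R4 q (NF P), (r.wo q).HSat Y Y
  · rw [hSat_derived_of_total hN hXY hT]
    simp only [h02] at hT ⊢
    -- Only the truth values of whole classes at $\langle X,Y\rangle$ and $\langle Y,Y\rangle$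
    -- matter from here on, so the goal is propositional.
    generalize (∀ r ∈ R q (NF P), (r.wo q).HSat Y Y) = a,
      (∀ r ∈ R q (NF P), (r.wo q).HSat X Y) = a',
      (∀ r ∈ R1 q (NF P) ∪ R4 q (NF P), (r.wo q).HSat Y Y) = b,
      (∀ r ∈ R1 q (NF P) ∪ R4 q (NF P), (r.wo q).HSat X Y) = b',
      (∀ r ∈ R0 q (NF P), (r.wo q).HSat Y Y) = c,
      (∀ r ∈ R0 q (NF P), (r.wo q).HSat X Y) = c',
      (∀ r ∈ R2 q (NF P), (r.wo q).HSat Y Y) = d,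
      (∀ r ∈ R2 q (NF P), (r.wo q).HSat X Y) = d',
      (∀ r ∈ R3 q (NF P) ∪ R4 q (NF P), (r.wo q).HSat Y Y) = e,
      (∀ r ∈ R3 q (NF P) ∪ R4 q (NF P), (r.wo q).HSat X Y) = e',
      (q ∈ sig P) = m at *
    clear hN hX hXq hqq hYq hYS hYP hY hXY h02
    grind
  -- Without a relevant extension the derived rules fail at $\langle Y,Y\rangle$, and the
  -- intersection is empty by convention.
  · refine iff_of_false (fun h => hT h.1.2) fun h => hT ?_
    rcases h.1 with h | ⟨h1, h2⟩
    · exact Or.inl h.1.2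
    · refine Or.inr ⟨h1.2.1.2, fun h => h2 ⟨h1.1, h1.2.1, h1.2.1.1, ?_, h⟩⟩
      exact ((h02 _).1 h1.2.1.2).2

end Characterization

/-! ### The result mentions only atoms of $\Sigma(P)\setminus\{q\}$. -/

section Signature

variable {α : Type*} [DecidableEq α] {q : α} {N : Program α} {r : Rule α}

/-- The atoms occurring in a set of literals. -/
def litSig (B : Finset (Lit α)) : Finset α := B.image Lit.atom

theorem litSig_union (B C : Finset (Lit α)) : litSig (B ∪ C) = litSig B ∪ litSig C :=
  Finset.image_union _ _

theorem litSig_singleton (l : Lit α) : litSig {l} = {l.atom} := Finset.image_singleton _ _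

theorem litSig_nots (H : Finset α) : litSig (nots H) = H := by
  rw [litSig, nots, Finset.image_image]
  exact Finset.image_id

theorem litSig_notnots (H : Finset α) : litSig (notnots H) = H := by
  rw [litSig, notnots, Finset.image_image]
  exact Finset.image_id

theorem litSig_notLits (B : Finset (Lit α)) : litSig (notLits B) = litSig B := by
  rw [litSig, notLits, Finset.image_image]
  exact Finset.image_congr fun l _ => by cases l <;> rfl

theorem litSig_notnotLits (B : Finset (Lit α)) : litSig (notnotLits B) = litSig B := by
  rw [litSig, notnotLits, Finset.image_image]
  exact Finset.image_congr fun l _ => by cases l <;> rfl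

theorem sig_eq_litSig : r.sig = r.head ∪ litSig r.body := rfl

theorem headWo_subset (hr : r ∈ N) : r.headWo q ⊆ (sig N).erase q :=
  Finset.erase_subset_erase q (Finset.subset_union_left.trans
    (Finset.subset_biUnion_of_mem Rule.sig hr))

theorem litSig_bodyWo_subset (hr : r ∈ N) : litSig (r.bodyWo q) ⊆ (sig N).erase q := by
  refine Finset.image_subset_iff.2 fun l hl => ?_
  obtain ⟨hl, hq⟩ := Finset.mem_filter.1 hl
  exact Finset.mem_erase.2 ⟨hq, Finset.mem_biUnion.2
    ⟨r, hr, Finset.mem_union_right _ (Finset.mem_image_of_mem _ hl)⟩⟩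

theorem litSig_asDual_subset {Q : Program α} {D : Finset (Lit α)} (hQ : Q ⊆ N)
    (hD : D ∈ asDual q Q) : litSig D ⊆ (sig N).erase q := by
  simp only [asDual, Finset.mem_biUnion, Finset.mem_image, Finset.mem_powerset,
    Finset.mem_product, Finset.mem_pi] at hD
  obtain ⟨F, hF, c, hc, rfl⟩ := hD
  rw [litSig_union, litSig_notLits, litSig_notnots, Finset.union_subset_iff, litSig,
    Finset.image_subset_iff, Finset.forall_mem_image, Finset.image_subset_iff]
  exact ⟨fun r _ => litSig_bodyWo_subset (hQ (hF r.2)) (Finset.mem_image_of_mem _ (hc.1 r.1 r.2)),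
    fun r _ => headWo_subset (hQ (Finset.mem_sdiff.1 r.2).1) (hc.2 r.1 r.2)⟩

/-- Reducedness is needed because the heads of $R_0$ and the bodies of $R_4$ are copied without
deleting $q$. -/
theorem sig_derived_subset (hN : ReducedAt q N) : sig (derived q N) ⊆ (sig N).erase q := by
  have hR : ∀ r ∈ R q N, r.sig ⊆ (sig N).erase q := fun r hr =>
    Finset.subset_erase.2 ⟨Finset.subset_biUnion_of_mem Rule.sig (Finset.mem_filter.1 hr).1,
      (Finset.mem_filter.1 hr).2⟩
  have m0 : R0 q N ⊆ N := Finset.filter_subset _ _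
  have m1 : R1 q N ⊆ N := Finset.filter_subset _ _
  have m2 : R2 q N ⊆ N := Finset.filter_subset _ _
  have m3 : R3 q N ⊆ N := Finset.filter_subset _ _
  have m4 : R4 q N ⊆ N := Finset.filter_subset _ _
  have m02 : R0 q N ∪ R2 q N ⊆ N := Finset.union_subset m0 m2
  have m14 : R1 q N ∪ R4 q N ⊆ N := Finset.union_subset m1 m4
  have m34 : R3 q N ∪ R4 q N ⊆ N := Finset.union_subset m3 m4
  have m02' : ∀ r, (R0 q N ∪ R2 q N) \ {r} ⊆ N := fun r => Finset.sdiff_subset.trans m02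
  have m14' : ∀ r, (R1 q N ∪ R4 q N) \ {r} ⊆ N := fun r => Finset.sdiff_subset.trans m14
  have h02 : ∀ r ∈ R0 q N ∪ R2 q N, r.head ⊆ (sig N).erase q := fun r hr =>
    hN.head_R0_union_R2 hr ▸ headWo_subset (m02 hr)
  have h0 : ∀ r ∈ R0 q N, r.head ⊆ (sig N).erase q := fun r hr =>
    h02 r (Finset.mem_union_left _ hr)
  have h2 : ∀ r ∈ R2 q N, r.head ⊆ (sig N).erase q := fun r hr =>
    h02 r (Finset.mem_union_right _ hr)
  have h4 : ∀ r ∈ R4 q N, litSig r.body ⊆ (sig N).erase q := fun r hr =>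
    hN.body_R4 hr ▸ litSig_bodyWo_subset (m4 hr)
  have hH : ∀ r ∈ N, r.headWo q ⊆ (sig N).erase q := fun r => headWo_subset
  have hB : ∀ r ∈ N, litSig (r.bodyWo q) ⊆ (sig N).erase q := fun r => litSig_bodyWo_subset
  rw [sig, Finset.biUnion_subset]
  simp only [derived, Finset.forall_mem_union]
  refine ⟨⟨⟨⟨⟨⟨⟨⟨⟨⟨hR, ?_⟩, ?_⟩, ?_⟩, ?_⟩, ?_⟩, ?_⟩, ?_⟩, ?_⟩, ?_⟩, ?_⟩
  all_goals
    simp only [rules1a, rules2a, rules3a, rules1b, rules2b, rules3b, rules4, rules5, rules6, rules7,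
      forall_mem_biUnion, Finset.forall_mem_image, sig_eq_litSig, litSig_union, litSig_singleton,
      litSig_nots, litSig_notnotLits, Finset.union_subset_iff,
      Finset.singleton_subset_iff, Lit.atom_pos, Lit.atom_nneg, Finset.mem_filter]
  · exact fun r hr s hs => ⟨⟨h0 r hr, hH s (m4 hs)⟩, hB r (m0 hr), h4 s hs⟩
  · exact fun r hr s hs t ht => ⟨⟨h0 r hr, hH s (m3 hs)⟩,
      ⟨⟨hB r (m0 hr), hB s (m3 hs)⟩, hH t (m14 ht)⟩, hB t (m14 ht)⟩
  · exact fun r hr s hs a ha D hD => ⟨h0 r hr, ⟨⟨⟨hB r (m0 hr), h0 r hr ha⟩,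
      litSig_asDual_subset (m02' r) hD⟩, hB s (m3 hs)⟩, hH s (m3 hs)⟩
  · exact fun r hr s hs => ⟨h2 r hr, ⟨hB r (m2 hr), hH s (m4 hs)⟩, h4 s hs⟩
  · exact fun r hr s hs t ht => ⟨h2 r hr, ⟨hB r (m2 hr), hH s (m3 hs), hH t (m14 ht)⟩,
      hB s (m3 hs), hB t (m14 ht)⟩
  · exact fun r hr s hs a ha D hD => ⟨h2 r hr, ⟨⟨hB r (m2 hr), hH s (m3 hs)⟩,
      hB s (m3 hs), h2 r hr ha⟩, litSig_asDual_subset (m02' r) hD⟩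
  · exact fun r hr D hD => ⟨hH r (m14 hr), hB r (m14 hr), litSig_asDual_subset m34 hD.1⟩
  · exact fun r hr s hs t ht D hD => ⟨hH r (m14 hr),
      ⟨⟨hB r (m14 hr), h02 t ht, hH s (m3 hs)⟩, hB t (m02 ht), hB s (m3 hs)⟩,
      litSig_asDual_subset m4 hD.1⟩
  · exact fun r hr s hs a ha D hD => ⟨hH r (m14 hr), ⟨⟨hB r (m14 hr), hH s (m3 hs)⟩,
      hB s (m3 hs), hH r (m14 hr) ha⟩, litSig_asDual_subset (m14' r) hD⟩
  · exact fun r hr s hs t ht a ha D hD =>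
      have ht' := m3 (Finset.mem_sdiff.1 ht).1
      ⟨⟨h0 r hr, hH s (m3 hs)⟩, ⟨⟨⟨hB r (m0 hr), hB s (m3 hs)⟩, hH t ht'⟩,
        hB t ht', h0 r hr ha⟩, litSig_asDual_subset (m02' r) hD⟩

theorem sig_fSP_subset (P : Program α) (q : α) :
    (↑(sig (fSP P q)) : Set α) ⊆ ↑(sig P) \ {q} := by
  rw [← Finset.coe_erase, Finset.coe_subset]
  exact (sig_NF_subset _).trans ((sig_derived_subset (reducedAt_NF q P)).trans
    (Finset.erase_subset_erase q (sig_NF_subset P)))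

end Signature

end ASP

/-! ### Membership in $\mathsf F_{SP}$ and uniqueness of the HT-models. -/

theorem mainTheorem1 (α : Type*) [DecidableEq α] :
    ASP.fSPOp α ∈ ASP.FSP α ∧
      ∀ f ∈ ASP.FSP α, ∀ (P : ASP.Program α) (q : α), ∀ P' ∈ f (P, ({q} : Set α)),
        ∀ S : Set α, ASP.HT S (ASP.fSP P q) = ASP.HT S P' := by
  constructor
  · constructor
    · intro P V P' hP'
      obtain ⟨q, rfl, rfl⟩ := (ASP.mem_fSPOp P P' V).1 hP'
      exact ASP.sig_fSP_subset P q
    · intro P V P' hP'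
      obtain ⟨q, rfl, rfl⟩ := (ASP.mem_fSPOp P P' V).1 hP'
      exact ASP.HT_fSP P q
  · rintro f ⟨hf, hf'⟩ P q P' hP' S
    exact ASP.HT_eq_of_HT_eq (ASP.sig_fSP_subset P q) (hf P _ P' hP')
      ((ASP.HT_fSP P q).trans (hf' P _ P' hP').symm) S
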